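/- Let $M$ be a connected, simply connected, finite-dimensional smooth manifold with a Riemannian metric $\widetilde g$ and let $Z$ be a smooth vector field with $\|Z\|_{\widetilde g}=1$. Let $V=\operatorname{span}\{Z\}$, let $\mathcal F$ be the foliation of $M$ tangent to $V$, let $D=V^{\perp}$ be the $\widetilde g$-orthogonal complement of $V$, and let $\mathrm{pr}_V,\mathrm{pr}_D$ be the orthogonal projections. Assume that $\mathcal F$ is a Riemannian foliation of $(M,\widetilde g)$, i.e. $\mathcal L_Y(\mathrm{pr}_D^*\widetilde g)=0$ for every smooth section $Y$ of $V$. For a Riemannian metric $g$, the second fundamental form of the leaves of $\mathcal F$ is $\mathrm{II}(A,B)=\mathrm{pr}\,\nabla^{g}_{\mathrm{pr}' A}\,\mathrm{pr}'B$, where $\nabla^g$ is the Levi-Civita connection and $\mathrm{pr}'$, $\mathrm{pr}$ are the $g$-orthogonal projections onto $V$ and onto its $g$-orthogonal complement; $\mathcal F$ is totally geodesic for $g$ if $\mathrm{II}=0$. Let $N=\mathrm{II}(Z,Z)$, computed with $\widetilde g$, be the mean curvature vector field of $\mathcal F$, and let $\mathcal R(X,Y)=\mathrm{pr}_V[\mathrm{pr}_DX,\mathrm{pr}_DY]$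 be the curvature of $D$, a vector-valued two-form; assume that $\mathcal R$ vanishes at no point of $M$. Let $\|\mathcal R\|_{\widetilde g}$ be its norm, $\|\mathcal R\|^2_{\widetilde g}=\sum_{i<j}\|\mathcal R(e_i,e_j)\|^2_{\widetilde g}$ for any $\widetilde g$-orthonormal basis $(e_i)$ of the tangent space. For a smooth function $f$ define $\nabla f$ and $\nabla^Df$ by $df(X)=\widetilde g(X,\nabla f)$ and $df(\mathrm{pr}_DX)=\widetilde g(X,\nabla^Df)$. Then there exists a Riemannian metric $g$ on $M$ such that $D$ and $V$ are $g$-orthogonal and $\mathcal F$ is totally geodesic for $g$ if and only if there exists $f\in C^\infty(M)$ such that $$N=-\nabla^D\log\|\mathcal R\|_{\widetilde g}+\nabla f .$$ -/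

import Mathlib

open Bundle Manifold VectorField
open scoped ContDiff

noncomputable section

namespace LineFoliation

section

variable {E : Type*} [NormedAddCommGroup E] [NormedSpace ℝ E]
  {M : Type*} [TopologicalSpace M] [ChartedSpace E M]

variable (E M) in
/-- Vector fields on the manifold `M` modelled on `E` (no regularity). -/
abbrev VField : Type _ := Π x : M, TangentSpace 𝓘(ℝ, E) x

variable [IsManifold 𝓘(ℝ, E) ∞ M]

/-- `X` is a smooth section of the tangent bundle. -/
def IsSmoothField (X : VField E M) : Prop :=
  ContMDiff 𝓘(ℝ, E) (𝓘(ℝ, E).prod 𝓘(ℝ, E)) ∞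
    (fun x ↦ (TotalSpace.mk' E x (X x) : TangentBundle 𝓘(ℝ, E) M))

variable (E M) in
/-- Smooth Riemannian metrics on `M`. -/
abbrev Metric : Type _ :=
  ContMDiffRiemannianMetric 𝓘(ℝ, E) ∞ E (fun x : M ↦ TangentSpace 𝓘(ℝ, E) x)

/-- The function `g(X, Y)`. -/
def innerFun (g : Metric E M) (X Y : VField E M) (x : M) : ℝ := g.inner x (X x) (Y x)

/-- The derivative `X f` of a function along a vector field. -/
def derivAlong (X : VField E M) (f : M → ℝ) (x : M) : ℝ := mvfderiv 𝓘(ℝ, E) f x (X x)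

/-! ### Musical isomorphism and gradients -/

variable [FiniteDimensional ℝ E]

instance (x : M) : FiniteDimensional ℝ (TangentSpace 𝓘(ℝ, E) x) :=
  inferInstanceAs (FiniteDimensional ℝ E)

instance (x : M) : T2Space (TangentSpace 𝓘(ℝ, E) x) :=
  inferInstanceAs (T2Space E)

/-- The isomorphism `v ↦ g(v, ·)` from `T_x M` to its dual. -/
def flat (g : Metric E M) (x : M) :
    TangentSpace 𝓘(ℝ, E) x ≃ₗ[ℝ] (TangentSpace 𝓘(ℝ, E) x →L[ℝ] ℝ) :=
  LinearEquiv.ofBijective (g.inner x).toLinearMap <| by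
    have hinj : Function.Injective (g.inner x).toLinearMap := by
      rw [← LinearMap.ker_eq_bot, LinearMap.ker_eq_bot']
      intro v hv
      by_contra h
      have h1 := g.pos x v h
      have h2 : g.inner x v = 0 := hv
      simp [h2] at h1
    refine ⟨hinj, ?_⟩
    let e : (TangentSpace 𝓘(ℝ, E) x →ₗ[ℝ] ℝ) ≃ₗ[ℝ] (TangentSpace 𝓘(ℝ, E) x →L[ℝ] ℝ) :=
      LinearMap.toContinuousLinearMap
    have : FiniteDimensional ℝ (TangentSpace 𝓘(ℝ, E) x →L[ℝ] ℝ) := e.finiteDimensional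
    refine (LinearMap.injective_iff_surjective_of_finrank_eq_finrank ?_).1 hinj
    rw [← e.finrank_eq]
    exact Subspace.dual_finrank_eq.symm

/-- The inverse isomorphism `T_x^* M → T_x M`. -/
def sharp (g : Metric E M) (x : M) :
    (TangentSpace 𝓘(ℝ, E) x →L[ℝ] ℝ) ≃ₗ[ℝ] TangentSpace 𝓘(ℝ, E) x := (flat g x).symm

theorem inner_sharp (g : Metric E M) (x : M) (α : TangentSpace 𝓘(ℝ, E) x →L[ℝ] ℝ)
    (w : TangentSpace 𝓘(ℝ, E) x) : g.inner x (sharp g x α) w = α w :=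
  congrArg (fun β : TangentSpace 𝓘(ℝ, E) x →L[ℝ] ℝ ↦ β w) ((flat g x).apply_symm_apply α)

/-- The gradient `∇f`: `df(X) = g(X, ∇f)`. -/
def gradient (g : Metric E M) (f : M → ℝ) : VField E M :=
  fun x ↦ sharp g x (mvfderiv 𝓘(ℝ, E) f x)

/-! ### The Levi-Civita connection -/

/-- Koszul's expression for `g(∇_X Y, W)`. -/
def koszul (g : Metric E M) (X Y W : VField E M) (x : M) : ℝ :=
  (1 / 2) * (derivAlong X (innerFun g Y W) x + derivAlong Y (innerFun g X W) x
    - derivAlong W (innerFun g X Y) x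
    + g.inner x (mlieBracket 𝓘(ℝ, E) X Y x) (W x)
    - g.inner x (mlieBracket 𝓘(ℝ, E) X W x) (Y x)
    - g.inner x (mlieBracket 𝓘(ℝ, E) Y W x) (X x))

theorem mdifferentiableAt_innerFun (g : Metric E M) {X Y : VField E M} {x : M}
    (hX : MDiffAt (T% X) x) (hY : MDiffAt (T% Y) x) : MDiffAt (innerFun g X Y) x := by
  have : MDifferentiableAt 𝓘(ℝ, E) (𝓘(ℝ, E).prod 𝓘(ℝ))
      (fun m ↦ TotalSpace.mk' ℝ (E := Bundle.Trivial M ℝ) m (g.inner m (X m) (Y m))) x := by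
    apply MDifferentiableAt.clm_bundle_apply₂ (F₁ := E) (F₂ := E)
    · exact g.contMDiff.mdifferentiable (by simp) x
    · exact hX
    · exact hY
  simp only [mdifferentiableAt_totalSpace] at this
  exact this.2

theorem tensorialAt_koszul_third (g : Metric E M) {X Y : VField E M} {x : M}
    (hX : MDiffAt (T% X) x) (hY : MDiffAt (T% Y) x) :
    TensorialAt 𝓘(ℝ, E) E (fun W ↦ koszul g X Y W x) x where
  smul {f W} hf hW := by
    have e1 : innerFun g Y (f • W) = f * innerFun g Y W := by
      ext y; simp [innerFun]
    have e2 : innerFun g X (f • W) = f * innerFun g X W := by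
      ext y; simp [innerFun]
    simp only [koszul, derivAlong, e1, e2, mvfderiv_mul hf (mdifferentiableAt_innerFun g hY hW),
      mvfderiv_mul hf (mdifferentiableAt_innerFun g hX hW), mlieBracket_smul_right hf hW]
    simp [innerFun, g.symm x (W x)]
    ring
  add {W W'} hW hW' := by
    have e1 : innerFun g Y (W + W') = innerFun g Y W + innerFun g Y W' := by
      ext y; simp [innerFun]
    have e2 : innerFun g X (W + W') = innerFun g X W + innerFun g X W' := by
      ext y; simp [innerFun]
    simp only [koszul, derivAlong, e1, e2,
      mvfderiv_add (mdifferentiableAt_innerFun g hY hW) (mdifferentiableAt_innerFun g hY hW'),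
      mvfderiv_add (mdifferentiableAt_innerFun g hX hW) (mdifferentiableAt_innerFun g hX hW'),
      mlieBracket_add_right hW hW']
    simp
    ring

theorem tensorialAt_koszul_first (g : Metric E M) {Y W : VField E M} {x : M}
    (hY : MDiffAt (T% Y) x) (hW : MDiffAt (T% W) x) :
    TensorialAt 𝓘(ℝ, E) E (fun X ↦ koszul g X Y W x) x where
  smul {f X} hf hX := by
    have e1 : innerFun g (f • X) W = f * innerFun g X W := by
      ext y; simp [innerFun]
    have e2 : innerFun g (f • X) Y = f * innerFun g X Y := by
      ext y; simp [innerFun]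
    simp only [koszul, derivAlong, e1, e2, mvfderiv_mul hf (mdifferentiableAt_innerFun g hX hW),
      mvfderiv_mul hf (mdifferentiableAt_innerFun g hX hY), mlieBracket_smul_left hf hX]
    simp [innerFun]
    ring
  add {X X'} hX hX' := by
    have e1 : innerFun g (X + X') W = innerFun g X W + innerFun g X' W := by
      ext y; simp [innerFun]
    have e2 : innerFun g (X + X') Y = innerFun g X Y + innerFun g X' Y := by
      ext y; simp [innerFun]
    simp only [koszul, derivAlong, e1, e2,
      mvfderiv_add (mdifferentiableAt_innerFun g hX hW) (mdifferentiableAt_innerFun g hX' hW),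
      mvfderiv_add (mdifferentiableAt_innerFun g hX hY) (mdifferentiableAt_innerFun g hX' hY),
      mlieBracket_add_left hX hX']
    simp
    ring

open Classical in
/-- `v ↦ ∇_v Y` at the point `x`, determined by Koszul's formula (and `0` by convention where `Y`
is not differentiable). -/
def leviCivitaAt (g : Metric E M) (Y : VField E M) (x : M) :
    TangentSpace 𝓘(ℝ, E) x →L[ℝ] TangentSpace 𝓘(ℝ, E) x :=
  if hY : MDiffAt (T% Y) x then
    LinearMap.toContinuousLinearMap ((sharp g x).toLinearMap ∘ₗ
      (TensorialAt.mkHom₂ (I := 𝓘(ℝ, E)) (F := E) (F' := E) (fun X W ↦ koszul g X Y W x) x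
        (fun _ hW ↦ tensorialAt_koszul_first g hY hW)
        (fun _ hX ↦ tensorialAt_koszul_third g hX hY)).toLinearMap)
  else 0

theorem inner_leviCivitaAt (g : Metric E M) {X Y W : VField E M} {x : M}
    (hX : MDiffAt (T% X) x) (hY : MDiffAt (T% Y) x) (hW : MDiffAt (T% W) x) :
    g.inner x (leviCivitaAt g Y x (X x)) (W x) = koszul g X Y W x := by
  rw [leviCivitaAt, dif_pos hY]
  simp only [LinearMap.coe_toContinuousLinearMap', LinearMap.comp_apply, LinearEquiv.coe_coe,
    inner_sharp, ContinuousLinearMap.coe_coe]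
  exact TensorialAt.mkHom₂_apply _ _ hX hW

theorem ext_inner (g : Metric E M) (x : M) {u v : TangentSpace 𝓘(ℝ, E) x}
    (h : ∀ w, g.inner x u w = g.inner x v w) : u = v :=
  (flat g x).injective (ContinuousLinearMap.ext h)

/-- The Levi-Civita connection of `g`; `leviCivita g Y x (X x)` is `∇_X Y` at `x`. -/
def leviCivita (g : Metric E M) :
    CovariantDerivative 𝓘(ℝ, E) E (TangentSpace 𝓘(ℝ, E) : M → Type _) where
  toFun := leviCivitaAt g
  isCovariantDerivativeOnUniv :=
    { add := by
        intro Y Y' x hY hY' _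
        have hYY : MDiffAt (T% (Y + Y')) x := mdifferentiableAt_add_section hY hY'
        ext v
        refine ext_inner g x fun w ↦ ?_
        have hv := FiberBundle.mdifferentiableAt_extend 𝓘(ℝ, E) E v
        have hw := FiberBundle.mdifferentiableAt_extend 𝓘(ℝ, E) E w
        have a := inner_leviCivitaAt g hv hYY hw
        have b := inner_leviCivitaAt g hv hY hw
        have c := inner_leviCivitaAt g hv hY' hw
        simp only [FiberBundle.extend_apply_self] at a b c
        simp only [_root_.add_apply, map_add, a, b, c]
        generalize FiberBundle.extend E v = X at *
        generalize FiberBundle.extend E w = W at *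
        have e1 : innerFun g (Y + Y') W = innerFun g Y W + innerFun g Y' W := by
          ext y; simp [innerFun]
        have e2 : innerFun g X (Y + Y') = innerFun g X Y + innerFun g X Y' := by
          ext y; simp [innerFun]
        simp only [koszul, derivAlong, e1, e2,
          mvfderiv_add (mdifferentiableAt_innerFun g hY hw) (mdifferentiableAt_innerFun g hY' hw),
          mvfderiv_add (mdifferentiableAt_innerFun g hv hY) (mdifferentiableAt_innerFun g hv hY'),
          mlieBracket_add_left hY hY', mlieBracket_add_right hY hY']
        simp
        ring
      leibniz := by
        intro Y f x hY hf _
        have hYY : MDiffAt (T% (f • Y)) x := hf.smul_section hY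
        ext v
        refine ext_inner g x fun w ↦ ?_
        have hv := FiberBundle.mdifferentiableAt_extend 𝓘(ℝ, E) E v
        have hw := FiberBundle.mdifferentiableAt_extend 𝓘(ℝ, E) E w
        have a := inner_leviCivitaAt g hv hYY hw
        have b := inner_leviCivitaAt g hv hY hw
        have ev : FiberBundle.extend E v x = v := FiberBundle.extend_apply_self E v
        have ew : FiberBundle.extend E w x = w := FiberBundle.extend_apply_self E w
        rw [ev, ew] at a b
        simp only [_root_.add_apply, _root_.smul_apply, map_add,
          map_smul, ContinuousLinearMap.smulRight_apply, smul_eq_mul, a, b]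
        generalize FiberBundle.extend E v = X at *
        generalize FiberBundle.extend E w = W at *
        subst ev ew
        have e1 : innerFun g (f • Y) W = f * innerFun g Y W := by
          ext y; simp [innerFun]
        have e2 : innerFun g X (f • Y) = f * innerFun g X Y := by
          ext y; simp [innerFun]
        simp only [koszul, derivAlong, e1, e2,
          mvfderiv_mul hf (mdifferentiableAt_innerFun g hY hw),
          mvfderiv_mul hf (mdifferentiableAt_innerFun g hv hY),
          mlieBracket_smul_left hf hY, mlieBracket_smul_right hf hY]
        simp [innerFun, g.symm x (Y x)]
        ring }

/-- The Levi-Civita connection is torsion-free. -/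
theorem torsion_leviCivita (g : Metric E M) : (leviCivita g).torsion = 0 := by
  rw [CovariantDerivative.torsion_eq_zero_iff]
  intro X Y x hX hY
  refine ext_inner g x fun w ↦ ?_
  have hw := FiberBundle.mdifferentiableAt_extend 𝓘(ℝ, E) E w
  have a := inner_leviCivitaAt g hX hY hw
  have b := inner_leviCivitaAt g hY hX hw
  have ew : FiberBundle.extend E w x = w := FiberBundle.extend_apply_self E w
  have e : innerFun g X Y = innerFun g Y X := by ext y; exact g.symm y _ _
  rw [ew] at a b
  change g.inner x (leviCivitaAt g Y x (X x) - leviCivitaAt g X x (Y x)) w = _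
  rw [map_sub, _root_.sub_apply, a, b]
  simp only [koszul, e, ew, mlieBracket_swap_apply (V := Y) (W := X), map_neg,
    _root_.neg_apply]
  ring

/-- The Levi-Civita connection is compatible with the metric. -/
theorem derivAlong_innerFun_leviCivita (g : Metric E M) {X Y W : VField E M} {x : M}
    (hX : MDiffAt (T% X) x) (hY : MDiffAt (T% Y) x) (hW : MDiffAt (T% W) x) :
    derivAlong X (innerFun g Y W) x =
      g.inner x (leviCivita g Y x (X x)) (W x) + g.inner x (Y x) (leviCivita g W x (X x)) := by
  change _ = g.inner x (leviCivitaAt g Y x (X x)) (W x) +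
    g.inner x (Y x) (leviCivitaAt g W x (X x))
  have e (A B : VField E M) : innerFun g A B = innerFun g B A := by ext y; exact g.symm y _ _
  rw [g.symm x (Y x), inner_leviCivitaAt g hX hY hW, inner_leviCivitaAt g hX hW hY]
  simp only [koszul, e W Y, e X Y, e X W, mlieBracket_swap_apply (V := W) (W := Y), map_neg,
    _root_.neg_apply]
  ring

/-! ### One-dimensional foliations

A nowhere vanishing smooth vector field `Z` spans a line subbundle `V` of `TM`. It has rank one,
hence is involutive, and is tangent to a foliation by curves. -/

/-- The fibre `V_x`, the line spanned by `Z`. -/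
def vertical (Z : VField E M) (x : M) : Submodule ℝ (TangentSpace 𝓘(ℝ, E) x) :=
  Submodule.span ℝ {Z x}

/-- The fibre `D_x`, the `g`-orthogonal complement of `V_x`. -/
def horizontal (g : Metric E M) (Z : VField E M) (x : M) :
    Submodule ℝ (TangentSpace 𝓘(ℝ, E) x) :=
  LinearMap.ker (g.inner x (Z x)).toLinearMap

/-- The `g`-orthogonal projection of `T_x M` onto `V_x = ℝ Z_x`, `v ↦ g(Z, v) / g(Z, Z) Z`. -/
def prV (g : Metric E M) (Z : VField E M) (x : M) :
    TangentSpace 𝓘(ℝ, E) x →L[ℝ] TangentSpace 𝓘(ℝ, E) x :=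
  ((g.inner x (Z x) (Z x))⁻¹ • g.inner x (Z x)).smulRight (Z x)

/-- The `g`-orthogonal projection of `T_x M` onto `V_x^⊥`. -/
def prD (g : Metric E M) (Z : VField E M) (x : M) :
    TangentSpace 𝓘(ℝ, E) x →L[ℝ] TangentSpace 𝓘(ℝ, E) x :=
  ContinuousLinearMap.id ℝ _ - prV g Z x

/-- The second fundamental form of the leaves, `II(A, B) = pr_D ∇_{pr_V A} pr_V B`, where `∇` and
the projections are those of `g`. -/
def secondFundamentalForm (g : Metric E M) (Z : VField E M) (A B : VField E M) : VField E M :=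
  fun x ↦ prD g Z x (leviCivita g (fun y ↦ prV g Z y (B y)) x (prV g Z x (A x)))

/-- The leaves are totally geodesic submanifolds of `(M, g)`: their second fundamental form
vanishes. -/
def IsTotallyGeodesic (g : Metric E M) (Z : VField E M) : Prop :=
  ∀ A B : VField E M, IsSmoothField A → IsSmoothField B →
    ∀ x, secondFundamentalForm g Z A B x = 0

/-- The mean curvature vector field `N = II(Z, Z)` of the leaves (for `Z` of unit length). -/
def meanCurvature (g : Metric E M) (Z : VField E M) : VField E M :=
  secondFundamentalForm g Z Z Z

/-- The Lie derivative `(L_Y T)(A, B) = Y T(A, B) - T([Y, A], B) - T(A, [Y, B])` of a covariant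
two-tensor. -/
def lieDerivative (T : Π x : M, TangentSpace 𝓘(ℝ, E) x → TangentSpace 𝓘(ℝ, E) x → ℝ)
    (Y A B : VField E M) (x : M) : ℝ :=
  derivAlong Y (fun y ↦ T y (A y) (B y)) x
    - T x (mlieBracket 𝓘(ℝ, E) Y A x) (B x) - T x (A x) (mlieBracket 𝓘(ℝ, E) Y B x)

/-- The tensor `pr_D^* g`. -/
def transverseMetric (g : Metric E M) (Z : VField E M) (x : M)
    (v w : TangentSpace 𝓘(ℝ, E) x) : ℝ :=
  g.inner x (prD g Z x v) (prD g Z x w)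

/-- The foliation is Riemannian: `L_Y pr_D^* g = 0` for every smooth section `Y` of `V`. -/
def IsRiemannianFoliation (g : Metric E M) (Z : VField E M) : Prop :=
  ∀ Y : VField E M, IsSmoothField Y → (∀ x, Y x ∈ vertical Z x) →
    ∀ A B : VField E M, IsSmoothField A → IsSmoothField B →
      ∀ x, lieDerivative (transverseMetric g Z) Y A B x = 0

/-- The curvature of `D` as an operation on vector fields, `ℛ(X, Y) = pr_V [pr_D X, pr_D Y]`. -/
def curvature (g : Metric E M) (Z : VField E M) (X Y : VField E M) : VField E M :=
  fun x ↦ prV g Z x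
    (mlieBracket 𝓘(ℝ, E) (fun y ↦ prD g Z y (X y)) (fun y ↦ prD g Z y (Y y)) x)

/-- The curvature of `D` as a tensor: its value on tangent vectors at `x` is computed with the
extensions of these vectors that are constant in the preferred chart at `x`, which does not matter
by `curvatureAt_apply`. -/
def curvatureAt (g : Metric E M) (Z : VField E M) (x : M)
    (v w : TangentSpace 𝓘(ℝ, E) x) : TangentSpace 𝓘(ℝ, E) x :=
  curvature g Z (FiberBundle.extend E v) (FiberBundle.extend E w) x

theorem mdifferentiableAt_prD (g : Metric E M) {Z X : VField E M} {x : M}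
    (hZ : MDiffAt (T% Z) x) (hZx : Z x ≠ 0) (hX : MDiffAt (T% X) x) :
    MDiffAt (T% (fun y ↦ prD g Z y (X y))) x := by
  have h1 := mdifferentiableAt_innerFun g hZ hZ
  have h2 := mdifferentiableAt_innerFun g hZ hX
  have h0 : innerFun g Z Z x ≠ 0 := (g.pos x (Z x) hZx).ne'
  have h3 : MDiffAt (fun y ↦ - ((innerFun g Z Z y)⁻¹ * innerFun g Z X y)) x := by
    exact ((h1.inv h0).mul h2).neg
  have h4 := mdifferentiableAt_add_section hX (h3.smul_section hZ)
  convert! h4 using 3 with y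
  simp [prD, prV, innerFun, sub_eq_add_neg]

theorem prV_prD (g : Metric E M) (Z : VField E M) (x : M) (v : TangentSpace 𝓘(ℝ, E) x) :
    prV g Z x (prD g Z x v) = 0 := by
  by_cases h : Z x = 0
  · simp [prV, h]
  · have := (g.pos x (Z x) h).ne'
    simp [prV, prD]
    field_simp
    simp

theorem tensorialAt_curvature_second (g : Metric E M) {Z X : VField E M} {x : M}
    (hZ : MDiffAt (T% Z) x) (hZx : Z x ≠ 0) :
    TensorialAt 𝓘(ℝ, E) E (fun Y ↦ curvature g Z X Y x) x where
  smul {f Y} hf hY := by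
    have e : (fun y ↦ prD g Z y ((f • Y) y)) = f • (fun y ↦ prD g Z y (Y y)) := by
      ext y; simp
    simp only [curvature]
    rw [e, mlieBracket_smul_right hf (mdifferentiableAt_prD g hZ hZx hY)]
    simp [prV_prD]
  add {Y Y'} hY hY' := by
    have e : (fun y ↦ prD g Z y ((Y + Y') y)) =
        (fun y ↦ prD g Z y (Y y)) + (fun y ↦ prD g Z y (Y' y)) := by
      ext y; simp
    simp only [curvature]
    rw [e, mlieBracket_add_right (mdifferentiableAt_prD g hZ hZx hY)
      (mdifferentiableAt_prD g hZ hZx hY')]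
    simp

theorem curvature_swap (g : Metric E M) (Z X Y : VField E M) (x : M) :
    curvature g Z X Y x = - curvature g Z Y X x := by
  simp only [curvature]
  rw [mlieBracket_swap_apply, map_neg]

theorem tensorialAt_curvature_first (g : Metric E M) {Z Y : VField E M} {x : M}
    (hZ : MDiffAt (T% Z) x) (hZx : Z x ≠ 0) :
    TensorialAt 𝓘(ℝ, E) E (fun X ↦ curvature g Z X Y x) x where
  smul {f X} hf hX := by
    have := (tensorialAt_curvature_second g (X := Y) hZ hZx).smul hf hX
    simp only [curvature_swap g Z _ Y, this, smul_neg]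
  add {X X'} hX hX' := by
    have := (tensorialAt_curvature_second g (X := Y) hZ hZx).add hX hX'
    simp only [curvature_swap g Z _ Y, this, neg_add]

theorem curvatureAt_apply (g : Metric E M) {Z X Y : VField E M} {x : M}
    (hZ : MDiffAt (T% Z) x) (hZx : Z x ≠ 0) (hX : MDiffAt (T% X) x) (hY : MDiffAt (T% Y) x) :
    curvatureAt g Z x (X x) (Y x) = curvature g Z X Y x :=
  TensorialAt.mkHom₂_apply (I := 𝓘(ℝ, E)) (F := E) (F' := E)
    (Φ := fun X Y ↦ curvature g Z X Y x)
    (fun _ _ ↦ tensorialAt_curvature_first g hZ hZx)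
    (fun _ _ ↦ tensorialAt_curvature_second g hZ hZx) hX hY

variable (E) in
/-- A basis of `T_x M`. -/
def tangentBasis (x : M) :
    Module.Basis (Fin (Module.finrank ℝ E)) ℝ (TangentSpace 𝓘(ℝ, E) x) :=
  Module.finBasis ℝ E

/-- The matrix `g_{ij}` of the metric at `x` in the basis `e_1, …, e_n = tangentBasis E x`. -/
def gram (g : Metric E M) (x : M) :
    Matrix (Fin (Module.finrank ℝ E)) (Fin (Module.finrank ℝ E)) ℝ :=
  Matrix.of fun i j ↦ g.inner x (tangentBasis E x i) (tangentBasis E x j)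

/-- The norm `‖ℛ‖` of the vector-valued two-form `ℛ` induced by `g`, with the inverse matrix
`g^{ij}` of `g_{ij}`: `‖ℛ‖² = 1/2 ∑ g^{ik} g^{jl} g(ℛ(e_i, e_j), ℛ(e_k, e_l))`, that is, the sum of
`g(ℛ(u_i, u_j), ℛ(u_i, u_j))` over `i < j` for any `g`-orthonormal basis `u` of `T_x M`. -/
def curvatureNorm (g : Metric E M) (Z : VField E M) (x : M) : ℝ :=
  Real.sqrt ((1 / 2) * ∑ i, ∑ j, ∑ k, ∑ l, (gram g x)⁻¹ i k * (gram g x)⁻¹ j l *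
    g.inner x (curvatureAt g Z x (tangentBasis E x i) (tangentBasis E x j))
      (curvatureAt g Z x (tangentBasis E x k) (tangentBasis E x l)))

/-- The horizontal gradient `∇^D f`: `df(pr_D X) = g(X, ∇^D f)`. -/
def horizontalGradient (g : Metric E M) (Z : VField E M) (f : M → ℝ) : VField E M :=
  fun x ↦ sharp g x ((mvfderiv 𝓘(ℝ, E) f x).comp (prD g Z x))

end

end LineFoliation

end

/-!
A metric `g` with `D ⟂ V` satisfies `g(Z, ·) = e^{2h} g₀(Z, ·)` for some smooth `h`, and the Koszul
formula shows that the leaves are totally geodesic for `g` if and only if `N = ∇^D h`.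

In that case the flow of `Y = e^{-h} Z` preserves `D`, and `ℒ_Y η = -dh(Y) η` for `η = g₀(Z, ·)`;
hence `ℒ_Y Ω = -dh(Y) Ω` for the scalar curvature form `Ω = g₀(Z, ℛ)`. As the foliation is
Riemannian, `ℒ_Y g₀` is a multiple of `η ⊗ η`, which does not affect the norm of `Ω` because
`Ω(Z, ·) = 0`. So `log ‖ℛ‖ + h` is constant along `Z`, and `f = log ‖ℛ‖ + h` satisfies `∇f = ∇^D f`,
which gives the formula for `N`. Conversely, pairing that formula with `Z` gives `df(Z) = 0`, hence
`N = ∇^D (f - log ‖ℛ‖)`, so the leaves are totally geodesic for `e^{2 (f - log ‖ℛ‖)} g₀`.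
-/

noncomputable section

namespace LineFoliation

section LinearAlgebra

variable {ι : Type*} [Fintype ι]

theorem sum_toMatrix_inv_mul_eq_sum_orthonormal [DecidableEq ι] {V : Type*} [AddCommGroup V]
    [Module ℝ V] (B β : LinearMap.BilinForm ℝ V)
    (b : Module.Basis ι ℝ V) {u : ι → V} (hu : ∀ i j, B (u i) (u j) = if i = j then 1 else 0) :
    ∑ i, ∑ k, (B.toMatrix b)⁻¹ i k * β (b i) (b k) = ∑ a, β (u a) (u a) := by
  let C : Matrix ι ι ℝ := Matrix.of fun a i ↦ b.repr (u a) i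
  have hform (γ : LinearMap.BilinForm ℝ V) (a c : ι) :
      γ (u a) (u c) = (C * γ.toMatrix b * C.transpose) a c := by
    simp only [LinearMap.BilinForm.apply_eq_dotProduct_toMatrix_mulVec b, Matrix.mul_assoc]
    rfl
  have hgram : C * B.toMatrix b * C.transpose = 1 := by
    ext a c
    rw [← hform, hu, Matrix.one_apply]
  have hinv : (B.toMatrix b)⁻¹ = C.transpose * C := by
    refine Matrix.inv_eq_right_inv ?_
    rwa [← Matrix.mul_assoc, mul_eq_one_comm, ← Matrix.mul_assoc]
  calc ∑ i, ∑ k, (B.toMatrix b)⁻¹ i k * β (b i) (b k)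
      = (C.transpose * C * (β.toMatrix b).transpose).trace := by
        simp only [hinv, Matrix.trace, Matrix.diag, Matrix.mul_apply (M := C.transpose * C),
          Matrix.transpose_apply, LinearMap.BilinForm.toMatrix_apply]
    _ = (C * β.toMatrix b * C.transpose).transpose.trace := by
        rw [Matrix.mul_assoc, Matrix.trace_mul_comm, Matrix.transpose_mul, Matrix.transpose_mul,
          Matrix.transpose_transpose, Matrix.mul_assoc]
    _ = ∑ a, β (u a) (u a) := by
        rw [Matrix.trace_transpose]
        simp only [Matrix.trace, Matrix.diag, hform]

theorem sum_sum_toMatrix_inv_mul_eq_sum_sq [DecidableEq ι] {V : Type*} [AddCommGroup V]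
    [Module ℝ V] (B Ω : LinearMap.BilinForm ℝ V)
    (b : Module.Basis ι ℝ V) {u : ι → V} (hu : ∀ i j, B (u i) (u j) = if i = j then 1 else 0) :
    ∑ i, ∑ j, ∑ k, ∑ l, (B.toMatrix b)⁻¹ i k * (B.toMatrix b)⁻¹ j l *
      (Ω (b i) (b j) * Ω (b k) (b l)) = ∑ p : ι × ι, Ω (u p.1) (u p.2) ^ 2 := by
  set G := B.toMatrix b
  calc ∑ i, ∑ j, ∑ k, ∑ l, G⁻¹ i k * G⁻¹ j l * (Ω (b i) (b j) * Ω (b k) (b l))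
      = ∑ i, ∑ k, G⁻¹ i k * ∑ j, ∑ l, G⁻¹ j l * (Ω (b i) (b j) * Ω (b k) (b l)) := by
        refine Finset.sum_congr rfl fun i _ ↦ ?_
        rw [Finset.sum_comm]
        simp only [Finset.mul_sum, mul_assoc]
    _ = ∑ i, ∑ k, G⁻¹ i k * ∑ c, Ω (b i) (u c) * Ω (b k) (u c) := by
        refine Finset.sum_congr rfl fun i _ ↦ Finset.sum_congr rfl fun k _ ↦ congrArg _ ?_
        exact sum_toMatrix_inv_mul_eq_sum_orthonormal B
          ((LinearMap.mul ℝ ℝ).compl₁₂ (Ω (b i)) (Ω (b k))) b hu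
    _ = ∑ c, ∑ i, ∑ k, G⁻¹ i k * (Ω (b i) (u c) * Ω (b k) (u c)) := by
        simp only [Finset.mul_sum]
        exact (Finset.sum_congr rfl fun i _ ↦ Finset.sum_comm).trans Finset.sum_comm
    _ = ∑ c, ∑ a, Ω (u a) (u c) * Ω (u a) (u c) := by
        refine Finset.sum_congr rfl fun c _ ↦ ?_
        exact sum_toMatrix_inv_mul_eq_sum_orthonormal B
          ((LinearMap.mul ℝ ℝ).compl₁₂ (Ω.flip (u c)) (Ω.flip (u c))) b hu
    _ = ∑ p : ι × ι, Ω (u p.1) (u p.2) ^ 2 := by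
        rw [Finset.sum_comm, Fintype.sum_prod_type]
        simp only [sq]

-- `Ω i j * Ω k j` is symmetric in `i` and `k`, so only the symmetric part of `A` contributes.
theorem sum_mul_sum_mul_eq_zero {A Ω : ι → ι → ℝ} {η : ι → ℝ} {c : ℝ}
    (hA : ∀ i k, A i k + A k i = c * (η i * η k)) (hΩ : ∀ j, ∑ i, η i * Ω i j = 0) :
    ∑ i, ∑ j, Ω i j * ∑ k, A i k * Ω k j = 0 := by
  have hswap : ∑ i, ∑ j, Ω i j * ∑ k, A i k * Ω k j = ∑ j, ∑ i, ∑ k, A i k * (Ω i j * Ω k j) := by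
    rw [Finset.sum_comm]
    simp only [Finset.mul_sum, mul_left_comm]
  have hsym (j : ι) : 2 * ∑ i, ∑ k, A i k * (Ω i j * Ω k j) = c * (∑ i, η i * Ω i j) ^ 2 := by
    calc 2 * ∑ i, ∑ k, A i k * (Ω i j * Ω k j)
        = ∑ i, ∑ k, A i k * (Ω i j * Ω k j) + ∑ k, ∑ i, A i k * (Ω i j * Ω k j) := by
          rw [two_mul, Finset.sum_comm (f := fun k i ↦ A i k * (Ω i j * Ω k j))]
      _ = ∑ i, ∑ k, (A i k + A k i) * (Ω i j * Ω k j) := by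
          simp only [← Finset.sum_add_distrib]
          refine Finset.sum_congr rfl fun i _ ↦ Finset.sum_congr rfl fun k _ ↦ by ring
      _ = c * (∑ i, η i * Ω i j) ^ 2 := by
          rw [sq, Finset.sum_mul_sum]
          simp only [hA, Finset.mul_sum]
          refine Finset.sum_congr rfl fun i _ ↦ Finset.sum_congr rfl fun k _ ↦ by ring
  rw [hswap]
  refine Finset.sum_eq_zero fun j _ ↦ ?_
  simpa [hΩ j] using hsym j

end LinearAlgebra

section SmoothFields

variable {E : Type*} [NormedAddCommGroup E] [NormedSpace ℝ E]
  {M : Type*} [TopologicalSpace M] [ChartedSpace E M] [IsManifold 𝓘(ℝ, E) ∞ M]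

theorem IsSmoothField.mdiffAt {X : VField E M} (hX : IsSmoothField X) (x : M) :
    MDiffAt (T% X) x := (hX x).mdifferentiableAt (by simp)

theorem IsSmoothField.smul {X : VField E M} {f : M → ℝ} (hf : ContMDiff 𝓘(ℝ, E) 𝓘(ℝ) ∞ f)
    (hX : IsSmoothField X) : IsSmoothField (f • X) := ContMDiff.smul_section hf hX

theorem IsSmoothField.sub {X Y : VField E M} (hX : IsSmoothField X) (hY : IsSmoothField Y) :
    IsSmoothField (X - Y) := ContMDiff.sub_section hX hY

theorem contMDiff_innerFun (g : Metric E M) {X Y : VField E M} (hX : IsSmoothField X)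
    (hY : IsSmoothField Y) : ContMDiff 𝓘(ℝ, E) 𝓘(ℝ) ∞ (innerFun g X Y) := by
  have h : ContMDiff 𝓘(ℝ, E) (𝓘(ℝ, E).prod 𝓘(ℝ)) ∞
      (fun m ↦ TotalSpace.mk' ℝ (E := Bundle.Trivial M ℝ) m (g.inner m (X m) (Y m))) :=
    ContMDiff.clm_bundle_apply₂ (F₁ := E) (F₂ := E) g.contMDiff hX hY
  exact fun x ↦ (contMDiffAt_totalSpace.1 (h x)).2

variable [FiniteDimensional ℝ E]

theorem IsSmoothField.mlieBracket {X Y : VField E M} (hX : IsSmoothField X)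
    (hY : IsSmoothField Y) : IsSmoothField (mlieBracket 𝓘(ℝ, E) X Y) := by
  have := FiniteDimensional.complete ℝ E
  have : IsManifold 𝓘(ℝ, E) (((⊤ : ℕ∞) : ℕ∞ω) + 1) M := inferInstanceAs (IsManifold 𝓘(ℝ, E) ∞ M)
  have : IsManifold 𝓘(ℝ, E) (minSmoothness ℝ 2) M :=
    IsManifold.of_le (n := ∞) (by simpa using ENat.LEInfty.out)
  exact ContDiff.mlieBracket_vectorField (m := ⊤) (n := ⊤) hX hY (by simp)

theorem mlieBracket_leibniz {U V W : VField E M} (hU : IsSmoothField U)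
    (hV : IsSmoothField V) (hW : IsSmoothField W) (x : M) :
    mlieBracket 𝓘(ℝ, E) U (mlieBracket 𝓘(ℝ, E) V W) x =
      mlieBracket 𝓘(ℝ, E) (mlieBracket 𝓘(ℝ, E) U V) W x
        + mlieBracket 𝓘(ℝ, E) V (mlieBracket 𝓘(ℝ, E) U W) x := by
  have := FiniteDimensional.complete ℝ E
  have h2 : minSmoothness ℝ 2 ≤ (∞ : ℕ∞ω) := by simpa using ENat.LEInfty.out
  have : IsManifold 𝓘(ℝ, E) (minSmoothness ℝ 3) M :=
    IsManifold.of_le (n := ∞) (by simpa using ENat.LEInfty.out)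
  exact leibniz_identity_mlieBracket_apply ((hU x).of_le h2) ((hV x).of_le h2) ((hW x).of_le h2)

variable [T2Space M]

theorem exists_isSmoothField_eventuallyEq {X : VField E M} {x₀ : M} {s : Set M}
    (hs : s ∈ nhds x₀) (hX : ContMDiffOn 𝓘(ℝ, E) (𝓘(ℝ, E).prod 𝓘(ℝ, E)) ∞ (T% X) s) :
    ∃ X' : VField E M, IsSmoothField X' ∧ ∀ᶠ x in nhds x₀, X' x = X x := by
  obtain ⟨u, hus, hu, hx₀⟩ := mem_nhds_iff.1 hs
  have hn := hu.mem_nhds hx₀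
  obtain ⟨ψ, hψ, -⟩ := (SmoothBumpFunction.nhds_basis_support (I := 𝓘(ℝ, E)) hn).mem_iff.1 hn
  refine ⟨(ψ : M → ℝ) • X, ψ.contMDiff.contMDiffOn.smul_section_of_tsupport hu hψ (hX.mono hus), ?_⟩
  filter_upwards [ψ.eventuallyEq_one] with x hx
  simp [hx]

theorem exists_isSmoothField_apply_eq {x₀ : M} (v : TangentSpace 𝓘(ℝ, E) x₀) :
    ∃ X : VField E M, IsSmoothField X ∧ X x₀ = v := by
  obtain ⟨s, hs, hsmooth⟩ :=
    FiberBundle.exists_contMDiffOn_extend (k := ∞) 𝓘(ℝ, E) E v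
  obtain ⟨X, hX, heq⟩ := exists_isSmoothField_eventuallyEq hs hsmooth
  exact ⟨X, hX, heq.self_of_nhds.trans (FiberBundle.extend_apply_self E v)⟩

end SmoothFields

section OrthonormalFrames

variable {E : Type*} [NormedAddCommGroup E] [NormedSpace ℝ E]
  {M : Type*} [TopologicalSpace M] [ChartedSpace E M] [IsManifold 𝓘(ℝ, E) ∞ M]
  {ι : Type*} [DecidableEq ι]

/-- The vectors `u i` form an orthonormal family in the Euclidean space `(T_x M, g_x)`. -/
def IsOrthonormal (g : Metric E M) {x : M} (u : ι → TangentSpace 𝓘(ℝ, E) x) : Prop :=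
  ∀ i j, g.inner x (u i) (u j) = if i = j then 1 else 0

namespace IsOrthonormal

variable {g : Metric E M} {x : M} {u : ι → TangentSpace 𝓘(ℝ, E) x}

theorem linearIndependent (hu : IsOrthonormal g u) : LinearIndependent ℝ u :=
  LinearMap.BilinForm.linearIndependent_of_iIsOrtho (B := (g.inner x).toLinearMap₁₂)
    (fun i j hij ↦ (hu i j).trans (if_neg hij)) fun i hi ↦ by
      exact one_ne_zero (((hu i i).trans (if_pos rfl)).symm.trans hi)

theorem inner_sum [Fintype ι] (hu : IsOrthonormal g u) (c : ι → ℝ) (j : ι) :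
    g.inner x (u j) (∑ i, c i • u i) = c j := by
  simp [hu j]

variable [FiniteDimensional ℝ E]

theorem sum_inner_smul [Fintype ι] (hu : IsOrthonormal g u)
    (hcard : Fintype.card ι = Module.finrank ℝ E) (v : TangentSpace 𝓘(ℝ, E) x) :
    ∑ i, g.inner x (u i) v • u i = v := by
  have hspan : Submodule.span ℝ (Set.range u) = ⊤ :=
    hu.linearIndependent.span_eq_top_of_card_eq_finrank' hcard
  have hv : v ∈ Submodule.span ℝ (Set.range u) := hspan ▸ Submodule.mem_top
  obtain ⟨c, rfl⟩ := (Submodule.mem_span_range_iff_exists_fun ℝ).1 hv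
  simp only [hu.inner_sum]

end IsOrthonormal

theorem IsOrthonormal.snoc {g : Metric E M} {x : M} {k : ℕ} {u : Fin k → TangentSpace 𝓘(ℝ, E) x}
    (hu : IsOrthonormal g u) {v : TangentSpace 𝓘(ℝ, E) x} (hv : g.inner x v v = 1)
    (huv : ∀ i, g.inner x (u i) v = 0) :
    IsOrthonormal g (Fin.snoc u v : Fin (k + 1) → TangentSpace 𝓘(ℝ, E) x) := by
  intro i j
  induction i using Fin.lastCases <;> induction j using Fin.lastCases
  · simpa using hv
  · simpa [g.symm x v, (Fin.castSucc_ne_last _).symm] using huv _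
  · simpa [Fin.castSucc_ne_last] using huv _
  · simpa using hu _ _

variable [FiniteDimensional ℝ E] [T2Space M]

theorem exists_unit_field (g : Metric E M) {W : VField E M} (hW : IsSmoothField W) {x₀ : M}
    (hx₀ : W x₀ ≠ 0) : ∃ U : VField E M, IsSmoothField U ∧ ∀ᶠ x in nhds x₀,
      g.inner x (U x) (U x) = 1 ∧ ∃ c : ℝ, U x = c • W x := by
  have hq := contMDiff_innerFun g hW hW
  have hs : {x | 0 < innerFun g W W x} ∈ nhds x₀ :=
    hq.continuous.continuousAt.eventually (lt_mem_nhds (g.pos x₀ _ hx₀))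
  have hsmooth : ContMDiffOn 𝓘(ℝ, E) (𝓘(ℝ, E).prod 𝓘(ℝ, E)) ∞
      (T% ((fun x ↦ (√(innerFun g W W x))⁻¹) • W)) {x | 0 < innerFun g W W x} := by
    refine ContMDiffOn.smul_section (fun x hx ↦ ?_) hW.contMDiffOn
    have hsqrt : ContDiffAt ℝ ∞ (fun t : ℝ ↦ (√t)⁻¹) (innerFun g W W x) :=
      (contDiffAt_id.sqrt hx.ne').inv (Real.sqrt_pos.2 hx).ne'
    exact (hsqrt.contMDiffAt.comp x (hq x)).contMDiffWithinAt
  obtain ⟨U, hU, heq⟩ := exists_isSmoothField_eventuallyEq hs hsmooth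
  refine ⟨U, hU, ?_⟩
  filter_upwards [hs, heq] with x hx hxU
  refine ⟨?_, _, hxU⟩
  have hsq : g.inner x (W x) (W x) = √(innerFun g W W x) ^ 2 := (Real.sq_sqrt hx.le).symm
  have hne : √(innerFun g W W x) ≠ 0 := (Real.sqrt_pos.2 hx).ne'
  simp only [hxU, Pi.smul_apply', map_smul, _root_.smul_apply, smul_eq_mul, hsq]
  field_simp

theorem exists_unit_field_orthogonal [Fintype ι] (g : Metric E M) {e : ι → VField E M} {x₀ : M}
    (he : ∀ i, IsSmoothField (e i)) (hon : ∀ᶠ x in nhds x₀, IsOrthonormal g (e · x))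
    (hcard : Fintype.card ι < Module.finrank ℝ E) :
    ∃ U : VField E M, IsSmoothField U ∧ ∀ᶠ x in nhds x₀,
      g.inner x (U x) (U x) = 1 ∧ ∀ i, g.inner x (e i x) (U x) = 0 := by
  obtain ⟨v, hv⟩ : ∃ v, v ∉ Submodule.span ℝ (Set.range (e · x₀)) := by
    by_contra! h
    have hrank := finrank_range_le_card (R := ℝ) (b := (e · x₀))
    rw [Set.finrank, (Submodule.eq_top_iff').2 h, finrank_top] at hrank
    exact hcard.not_ge hrank
  obtain ⟨X, hX, rfl⟩ := exists_isSmoothField_apply_eq v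
  set W : VField E M := X - fun x ↦ ∑ i, (innerFun g (e i) X • e i) x with hWdef
  have hW : IsSmoothField W :=
    hX.sub (ContMDiff.sum_section fun i _ ↦ (he i).smul (contMDiff_innerFun g (he i) hX))
  have hWx₀ : W x₀ ≠ 0 := by
    intro h
    refine hv ?_
    rw [sub_eq_zero.1 h]
    exact Submodule.sum_mem _ fun i _ ↦
      Submodule.smul_mem _ _ (Submodule.subset_span (Set.mem_range_self i))
  obtain ⟨U, hU, hunit⟩ := exists_unit_field g hW hWx₀
  refine ⟨U, hU, ?_⟩
  filter_upwards [hunit, hon] with x ⟨hUU, c, hUW⟩ hx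
  have hWe (i : ι) : g.inner x (e i x) (W x) = 0 := by
    have := hx.inner_sum (fun j ↦ innerFun g (e j) X x) i
    simp_all [innerFun]
  exact ⟨hUU, fun i ↦ by rw [hUW, map_smul, hWe, smul_zero]⟩

theorem exists_orthonormal_fields (g : Metric E M) (x₀ : M) (k : ℕ)
    (hk : k ≤ Module.finrank ℝ E) :
    ∃ e : Fin k → VField E M, (∀ i, IsSmoothField (e i)) ∧
      ∀ᶠ x in nhds x₀, IsOrthonormal g (e · x) := by
  induction k with
  | zero => exact ⟨Fin.elim0, fun i ↦ i.elim0, .of_forall fun _ i ↦ i.elim0⟩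
  | succ k ih =>
    obtain ⟨e, he, hon⟩ := ih (Nat.le_of_succ_le hk)
    obtain ⟨U, hU, hperp⟩ := exists_unit_field_orthogonal g he hon (by simpa using hk)
    refine ⟨Fin.snoc e U, Fin.lastCases (by simpa using hU) (by simpa using he), ?_⟩
    filter_upwards [hon, hperp] with x hx ⟨hUU, heU⟩
    convert! hx.snoc hUU heU with i
    induction i using Fin.lastCases <;> simp

end OrthonormalFrames

section Projections

variable {E : Type*} [NormedAddCommGroup E] [NormedSpace ℝ E]
  {M : Type*} [TopologicalSpace M] [ChartedSpace E M] [IsManifold 𝓘(ℝ, E) ∞ M]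
  (g : Metric E M) {Z : VField E M} {x : M}

theorem ne_zero_of_unit (hunit : g.inner x (Z x) (Z x) = 1) : Z x ≠ 0 := by
  rintro h
  simp [h] at hunit

theorem prV_apply_of_unit (hunit : g.inner x (Z x) (Z x) = 1) (v : TangentSpace 𝓘(ℝ, E) x) :
    prV g Z x v = g.inner x (Z x) v • Z x := by
  simp [prV, hunit]

theorem prD_apply_of_unit (hunit : g.inner x (Z x) (Z x) = 1) (v : TangentSpace 𝓘(ℝ, E) x) :
    prD g Z x v = v - g.inner x (Z x) v • Z x := by
  simp [prD, prV_apply_of_unit g hunit]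

theorem prD_self (hZx : Z x ≠ 0) : prD g Z x (Z x) = 0 := by
  have := (g.pos x (Z x) hZx).ne'
  simp [prD, prV, this]

theorem inner_prD_of_unit (hunit : g.inner x (Z x) (Z x) = 1) (v : TangentSpace 𝓘(ℝ, E) x) :
    g.inner x (Z x) (prD g Z x v) = 0 := by
  simp [prD_apply_of_unit g hunit, hunit]

theorem inner_prD_left (Z : VField E M) (v w : TangentSpace 𝓘(ℝ, E) x) :
    g.inner x (prD g Z x v) w = g.inner x v (prD g Z x w) := by
  simp only [prD, prV, _root_.sub_apply, ContinuousLinearMap.id_apply, map_sub,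
    ContinuousLinearMap.smulRight_apply, _root_.smul_apply, map_smul, smul_eq_mul, g.symm x v (Z x)]
  ring

theorem inner_eq_transverseMetric_add (hunit : g.inner x (Z x) (Z x) = 1)
    (v w : TangentSpace 𝓘(ℝ, E) x) :
    g.inner x v w = transverseMetric g Z x v w + g.inner x (Z x) v * g.inner x (Z x) w := by
  simp only [transverseMetric, prD_apply_of_unit g hunit, map_sub, map_smul, _root_.sub_apply,
    _root_.smul_apply, smul_eq_mul, hunit, g.symm x v (Z x)]
  ring

theorem IsSmoothField.prD {X : VField E M} (hZ : IsSmoothField Z)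
    (hunit : ∀ x, g.inner x (Z x) (Z x) = 1) (hX : IsSmoothField X) :
    IsSmoothField (fun x ↦ prD g Z x (X x)) := by
  have h := hX.sub (hZ.smul (contMDiff_innerFun g hZ hX))
  convert! h using 1
  ext x
  simp [prD_apply_of_unit g (hunit x), innerFun]

end Projections

section CurvatureNorm

variable {E : Type*} [NormedAddCommGroup E] [NormedSpace ℝ E]
  {M : Type*} [TopologicalSpace M] [ChartedSpace E M] [IsManifold 𝓘(ℝ, E) ∞ M]
  (g : Metric E M) {Z : VField E M} {x : M}

variable (Z) in
/-- The function `Ω(X, Y) = g(Z, [pr_D X, pr_D Y])` given by the scalar curvature form of `D`. -/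
def curvatureFun (X Y : VField E M) : M → ℝ :=
  innerFun g Z (mlieBracket 𝓘(ℝ, E) (fun y ↦ prD g Z y (X y)) (fun y ↦ prD g Z y (Y y)))

theorem curvatureFun_swap (X Y : VField E M) :
    curvatureFun g Z X Y x = -curvatureFun g Z Y X x := by
  rw [curvatureFun, innerFun, mlieBracket_swap_apply, map_neg]
  rfl

theorem curvatureFun_self_left (hZ : ∀ x, Z x ≠ 0) (X : VField E M) : curvatureFun g Z Z X = 0 := by
  have hprD : (fun y ↦ prD g Z y (Z y)) = 0 := funext fun y ↦ prD_self g (hZ y)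
  ext y
  simp [curvatureFun, innerFun, hprD, mlieBracket_zero_left]

variable [FiniteDimensional ℝ E]

/-- The scalar curvature form `Ω(v, w) = g(Z, ℛ(v, w))` of `D` at `x`, for which `ℛ = Ω ⊗ Z` when
`Z` has unit length. The hypotheses make `ℛ` tensorial at `x`, hence `Ω` well defined. -/
def curvatureForm (hZ : MDiffAt (T% Z) x) (hZx : Z x ≠ 0) :
    LinearMap.BilinForm ℝ (TangentSpace 𝓘(ℝ, E) x) :=
  (TensorialAt.mkHom₂ (I := 𝓘(ℝ, E)) (F := E) (F' := E) (fun X Y ↦ curvature g Z X Y x) x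
    (fun _ _ ↦ tensorialAt_curvature_first g hZ hZx)
    (fun _ _ ↦ tensorialAt_curvature_second g hZ hZx)).toLinearMap₁₂.compr₂
      (g.inner x (Z x)).toLinearMap

theorem curvatureForm_apply (hZ : MDiffAt (T% Z) x) (hZx : Z x ≠ 0)
    (v w : TangentSpace 𝓘(ℝ, E) x) :
    curvatureForm g hZ hZx v w = g.inner x (Z x) (curvatureAt g Z x v w) := rfl

theorem curvatureAt_eq_smul (hZ : MDiffAt (T% Z) x) (hunit : g.inner x (Z x) (Z x) = 1)
    (v w : TangentSpace 𝓘(ℝ, E) x) :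
    curvatureAt g Z x v w = curvatureForm g hZ (ne_zero_of_unit g hunit) v w • Z x := by
  simp [curvatureForm_apply, curvatureAt, curvature, prV_apply_of_unit g hunit, hunit]

theorem curvatureForm_apply_field (hZ : MDiffAt (T% Z) x) (hunit : g.inner x (Z x) (Z x) = 1)
    {X Y : VField E M} (hX : MDiffAt (T% X) x) (hY : MDiffAt (T% Y) x) :
    curvatureForm g hZ (ne_zero_of_unit g hunit) (X x) (Y x) = curvatureFun g Z X Y x := by
  rw [curvatureForm_apply, curvatureAt_apply g hZ (ne_zero_of_unit g hunit) hX hY]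
  simp [curvature, curvatureFun, innerFun, prV_apply_of_unit g hunit, hunit]

theorem curvatureFun_eq_sum (hZ : MDiffAt (T% Z) x) (hunit : g.inner x (Z x) (Z x) = 1)
    {e : Fin (Module.finrank ℝ E) → VField E M} (he : ∀ i, MDiffAt (T% (e i)) x)
    (hon : IsOrthonormal g (e · x)) {X Y : VField E M} (hX : MDiffAt (T% X) x)
    (hY : MDiffAt (T% Y) x) :
    curvatureFun g Z X Y x = ∑ k, g.inner x (e k x) (X x) * curvatureFun g Z (e k) Y x := by
  rw [← curvatureForm_apply_field g hZ hunit hX hY]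
  conv_lhs => rw [← hon.sum_inner_smul (by simp) (X x)]
  simp [curvatureForm_apply_field g hZ hunit (he _) hY]

theorem contMDiff_curvatureFun (hZ : IsSmoothField Z) (hunit : ∀ x, g.inner x (Z x) (Z x) = 1)
    {X Y : VField E M} (hX : IsSmoothField X) (hY : IsSmoothField Y) :
    ContMDiff 𝓘(ℝ, E) 𝓘(ℝ) ∞ (curvatureFun g Z X Y) :=
  contMDiff_innerFun g hZ ((hZ.prD g hunit hX).mlieBracket (hZ.prD g hunit hY))

theorem curvatureNorm_eq_sqrt (hZ : MDiffAt (T% Z) x) (hunit : g.inner x (Z x) (Z x) = 1)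
    {u : Fin (Module.finrank ℝ E) → TangentSpace 𝓘(ℝ, E) x} (hu : IsOrthonormal g u) :
    curvatureNorm g Z x = √((1 / 2) *
      ∑ p : _ × _, curvatureForm g hZ (ne_zero_of_unit g hunit) (u p.1) (u p.2) ^ 2) := by
  have hgram : gram g x = LinearMap.BilinForm.toMatrix (tangentBasis E x)
      (g.inner x).toLinearMap₁₂ := by
    ext i j
    simp [gram, LinearMap.BilinForm.toMatrix_apply]
  have hinner (v w v' w') : g.inner x (curvatureAt g Z x v w) (curvatureAt g Z x v' w') =
      curvatureForm g hZ (ne_zero_of_unit g hunit) v w *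
        curvatureForm g hZ (ne_zero_of_unit g hunit) v' w' := by
    simp [curvatureAt_eq_smul g hZ hunit, hunit, mul_comm]
  rw [curvatureNorm, hgram, ← sum_sum_toMatrix_inv_mul_eq_sum_sq (g.inner x).toLinearMap₁₂
    (curvatureForm g hZ (ne_zero_of_unit g hunit)) (tangentBasis E x) hu]
  simp only [hinner]

theorem curvatureNorm_pos [T2Space M] (hZ : MDiffAt (T% Z) x) (hunit : g.inner x (Z x) (Z x) = 1)
    (hcurv : ∃ v w, curvatureAt g Z x v w ≠ 0) : 0 < curvatureNorm g Z x := by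
  obtain ⟨e, -, hon⟩ := exists_orthonormal_fields g x _ le_rfl
  have hu := hon.self_of_nhds
  rw [curvatureNorm_eq_sqrt g hZ hunit hu, Real.sqrt_pos]
  refine mul_pos one_half_pos ((Finset.sum_nonneg fun _ _ ↦ sq_nonneg _).lt_of_ne' fun h ↦ ?_)
  obtain ⟨v, w, hvw⟩ := hcurv
  refine hvw ?_
  have hΩ (i j) : curvatureForm g hZ (ne_zero_of_unit g hunit) (e i x) (e j x) = 0 :=
    pow_eq_zero_iff two_ne_zero |>.1 <|
      (Finset.sum_eq_zero_iff_of_nonneg fun _ _ ↦ sq_nonneg _).1 h (i, j) (Finset.mem_univ _)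
  rw [curvatureAt_eq_smul g hZ hunit, ← hu.sum_inner_smul (by simp) v,
    ← hu.sum_inner_smul (by simp) w]
  simp [hΩ]

theorem log_curvatureNorm_eventuallyEq (hZ : IsSmoothField Z)
    (hunit : ∀ x, g.inner x (Z x) (Z x) = 1) {e : Fin (Module.finrank ℝ E) → VField E M}
    (he : ∀ i, IsSmoothField (e i)) (hon : ∀ᶠ y in nhds x, IsOrthonormal g (e · y)) :
    (fun y ↦ Real.log (curvatureNorm g Z y)) =ᶠ[nhds x] fun y ↦
      (1 / 2) * Real.log ((1 / 2) * ∑ p : _ × _, curvatureFun g Z (e p.1) (e p.2) y ^ 2) := by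
  filter_upwards [hon] with y hy
  rw [curvatureNorm_eq_sqrt g (hZ.mdiffAt y) (hunit y) hy, Real.log_sqrt (by positivity)]
  simp only [curvatureForm_apply_field g (hZ.mdiffAt y) (hunit y) ((he _).mdiffAt y)
    ((he _).mdiffAt y)]
  ring

theorem sum_sq_curvatureFun_pos [T2Space M] (hZ : IsSmoothField Z)
    (hunit : g.inner x (Z x) (Z x) = 1) (hcurv : ∃ v w, curvatureAt g Z x v w ≠ 0)
    {e : Fin (Module.finrank ℝ E) → VField E M} (he : ∀ i, IsSmoothField (e i))
    (hon : IsOrthonormal g (e · x)) :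
    0 < ∑ p : _ × _, curvatureFun g Z (e p.1) (e p.2) x ^ 2 := by
  have h := curvatureNorm_pos g (hZ.mdiffAt x) hunit hcurv
  simpa only [curvatureNorm_eq_sqrt g (hZ.mdiffAt x) hunit hon, Real.sqrt_pos,
    curvatureForm_apply_field g (hZ.mdiffAt x) hunit ((he _).mdiffAt x) ((he _).mdiffAt x),
    one_half_pos, mul_pos_iff_of_pos_left] using h

theorem contMDiff_log_curvatureNorm [T2Space M] (hZ : IsSmoothField Z)
    (hunit : ∀ x, g.inner x (Z x) (Z x) = 1) (hcurv : ∀ x, ∃ v w, curvatureAt g Z x v w ≠ 0) :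
    ContMDiff 𝓘(ℝ, E) 𝓘(ℝ) ∞ fun x ↦ Real.log (curvatureNorm g Z x) := by
  intro x
  obtain ⟨e, he, hon⟩ := exists_orthonormal_fields g x _ le_rfl
  have hpos := sum_sq_curvatureFun_pos g hZ (hunit x) (hcurv x) he hon.self_of_nhds
  have hsum : ContMDiffAt 𝓘(ℝ, E) 𝓘(ℝ) ∞
      (fun y ↦ ∑ p : _ × _, curvatureFun g Z (e p.1) (e p.2) y ^ 2) x :=
    contMDiffAt_finsetSum fun p _ ↦ (contMDiff_curvatureFun g hZ hunit (he p.1) (he p.2) x).pow 2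
  have hlog : ContDiffAt ℝ ∞ (fun t ↦ (1 / 2) * Real.log ((1 / 2) * t))
      (∑ p : _ × _, curvatureFun g Z (e p.1) (e p.2) x ^ 2) :=
    contDiffAt_const.mul ((contDiffAt_const.mul contDiffAt_id).log (by positivity))
  have hcomp := hlog.contMDiffAt.comp x hsum
  exact hcomp.congr_of_eventuallyEq (log_curvatureNorm_eventuallyEq g hZ hunit he hon)

end CurvatureNorm

section Derivatives

variable {E : Type*} [NormedAddCommGroup E] [NormedSpace ℝ E]
  {M : Type*} [TopologicalSpace M] [ChartedSpace E M] {x : M}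

theorem mvfderiv_comp_real {φ : ℝ → ℝ} {φ' : ℝ} {F : M → ℝ} (hφ : HasDerivAt φ φ' (F x))
    (hF : MDiffAt F x) (v : TangentSpace 𝓘(ℝ, E) x) :
    mvfderiv 𝓘(ℝ, E) (fun y ↦ φ (F y)) x v = φ' * mvfderiv 𝓘(ℝ, E) F x v := by
  have h := (hφ.hasFDerivAt.hasMFDerivAt.comp x hF.hasMFDerivAt).mfderiv
  change (mfderiv 𝓘(ℝ, E) 𝓘(ℝ, ℝ) (φ ∘ F) x) v = φ' * (show ℝ from mfderiv 𝓘(ℝ, E) 𝓘(ℝ, ℝ) F x v)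
  rw [h]
  exact mul_comm (show ℝ from mfderiv 𝓘(ℝ, E) 𝓘(ℝ, ℝ) F x v) φ'

theorem mvfderiv_exp_neg {h : M → ℝ} (hh : MDiffAt h x) (v : TangentSpace 𝓘(ℝ, E) x) :
    mvfderiv 𝓘(ℝ, E) (fun y ↦ Real.exp (-h y)) x v =
      -Real.exp (-h x) * mvfderiv 𝓘(ℝ, E) h x v :=
  mvfderiv_comp_real (φ := fun t ↦ Real.exp (-t)) (by simpa using (hasDerivAt_neg (h x)).exp) hh v

theorem mvfderiv_congr {f f' : M → ℝ} (h : f =ᶠ[nhds x] f') :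
    mvfderiv 𝓘(ℝ, E) f x = mvfderiv 𝓘(ℝ, E) f' x := by
  simp only [mvfderiv, h.mfderiv_eq]
  rfl

theorem mvfderiv_sum {ι : Type} {s : Finset ι} {f : ι → M → ℝ} (hf : ∀ i ∈ s, MDiffAt (f i) x) :
    mvfderiv 𝓘(ℝ, E) (∑ i ∈ s, f i) x = ∑ i ∈ s, mvfderiv 𝓘(ℝ, E) (f i) x := by
  classical
  induction s using Finset.induction_on with
  | empty => simp
  | insert a s ha ih =>
    rw [Finset.forall_mem_insert] at hf
    rw [Finset.sum_insert ha, Finset.sum_insert ha, mvfderiv_add hf.1 (MDifferentiableAt.sum hf.2),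
      ih hf.2]

theorem mvfderiv_sum_sq {ι : Type} {s : Finset ι} {f : ι → M → ℝ}
    (hf : ∀ i ∈ s, MDiffAt (f i) x) (v : TangentSpace 𝓘(ℝ, E) x) :
    mvfderiv 𝓘(ℝ, E) (fun y ↦ ∑ i ∈ s, f i y ^ 2) x v =
      2 * ∑ i ∈ s, f i x * mvfderiv 𝓘(ℝ, E) (f i) x v := by
  have hfun : (fun y ↦ ∑ i ∈ s, f i y ^ 2) = ∑ i ∈ s, f i * f i := by
    ext y
    simp [sq]
  rw [hfun, mvfderiv_sum fun i hi ↦ (hf i hi).mul (hf i hi), _root_.sum_apply, Finset.mul_sum]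
  refine Finset.sum_congr rfl fun i hi ↦ ?_
  simp only [mvfderiv_mul (hf i hi) (hf i hi), _root_.add_apply, _root_.smul_apply, smul_eq_mul]
  ring

end Derivatives

section TotallyGeodesic

variable {E : Type*} [NormedAddCommGroup E] [NormedSpace ℝ E]
  {M : Type*} [TopologicalSpace M] [ChartedSpace E M] [IsManifold 𝓘(ℝ, E) ∞ M]
  {g g₀ : Metric E M} {Z : VField E M} {x : M}

theorem prD_eq_of_inner_eq {u : ℝ} (hu : u ≠ 0)
    (hg : ∀ v, g.inner x (Z x) v = u * g₀.inner x (Z x) v) : prD g Z x = prD g₀ Z x := by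
  ext v
  simp only [prD, prV, _root_.sub_apply, ContinuousLinearMap.smulRight_apply, _root_.smul_apply,
    hg, smul_eq_mul]
  congr 2
  field_simp

theorem exists_inner_eq_exp_mul (hZ : IsSmoothField Z)
    (hunit : ∀ x, g₀.inner x (Z x) (Z x) = 1)
    (horth : ∀ x, ∀ v ∈ horizontal g₀ Z x, ∀ w ∈ vertical Z x, g.inner x v w = 0) :
    ∃ h : M → ℝ, ContMDiff 𝓘(ℝ, E) 𝓘(ℝ) ∞ h ∧
      ∀ x v, g.inner x (Z x) v = Real.exp (2 * h x) * g₀.inner x (Z x) v := by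
  have hpos (x : M) : 0 < g.inner x (Z x) (Z x) := g.pos x _ (ne_zero_of_unit g₀ (hunit x))
  refine ⟨fun x ↦ (1 / 2) * Real.log (innerFun g Z Z x), fun x ↦ ?_, fun x v ↦ ?_⟩
  · exact contMDiffAt_const.mul
      ((Real.contDiffAt_log.2 (hpos x).ne').contMDiffAt.comp x (contMDiff_innerFun g hZ hZ x))
  · have hZD : g.inner x (Z x) (prD g₀ Z x v) = 0 := by
      rw [g.symm]
      exact horth x _ (inner_prD_of_unit g₀ (hunit x) v) _ (Submodule.mem_span_singleton_self _)
    rw [prD_apply_of_unit g₀ (hunit x), map_sub, map_smul, smul_eq_mul, sub_eq_zero] at hZD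
    rw [hZD, ← mul_assoc, mul_one_div_cancel two_ne_zero, one_mul, innerFun, Real.exp_log (hpos x),
      mul_comm]

/-- The conformal rescaling `e^{2h} g` of a metric. -/
def conformal (g : Metric E M) (h : M → ℝ) (hh : ContMDiff 𝓘(ℝ, E) 𝓘(ℝ) ∞ h) : Metric E M where
  inner x := Real.exp (2 * h x) • g.inner x
  symm x v w := by simp [g.symm x v w]
  pos x v hv := by simpa using mul_pos (Real.exp_pos _) (g.pos x v hv)
  isVonNBounded x := by
    refine ((g.isVonNBounded x).image
      ((Real.exp (h x))⁻¹ • ContinuousLinearMap.id ℝ (TangentSpace 𝓘(ℝ, E) x))).subset ?_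
    intro v hv
    refine ⟨Real.exp (h x) • v, ?_, ?_⟩
    · simpa [two_mul, Real.exp_add, mul_assoc] using hv
    · simp [smul_smul, (Real.exp_pos (h x)).ne']
  contMDiff := by
    have hexp : ContMDiff 𝓘(ℝ, E) 𝓘(ℝ) ∞ (fun x ↦ Real.exp (2 * h x)) :=
      (Real.contDiff_exp.comp (contDiff_const.mul contDiff_id)).contMDiff.comp hh
    exact ContMDiff.smul_section hexp g.contMDiff

theorem inner_conformal_eq_zero {h : M → ℝ} {hh : ContMDiff 𝓘(ℝ, E) 𝓘(ℝ) ∞ h}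
    {v w : TangentSpace 𝓘(ℝ, E) x} (hv : v ∈ horizontal g Z x) (hw : w ∈ vertical Z x) :
    (conformal g h hh).inner x v w = 0 := by
  obtain ⟨c, rfl⟩ := Submodule.mem_span_singleton.1 hw
  have hZv : g.inner x (Z x) v = 0 := hv
  simp [conformal, g.symm x v, hZv]

variable [FiniteDimensional ℝ E]

theorem secondFundamentalForm_eq_smul {A B : VField E M} (hZ : MDiffAt (T% Z) x) (hZx : Z x ≠ 0)
    (hB : MDiffAt (T% B) x) :
    secondFundamentalForm g Z A B x =
      (((g.inner x (Z x) (Z x))⁻¹ * g.inner x (Z x) (A x)) *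
        ((g.inner x (Z x) (Z x))⁻¹ * g.inner x (Z x) (B x))) •
        prD g Z x (leviCivita g Z x (Z x)) := by
  have hb : MDiffAt (fun y ↦ (innerFun g Z Z y)⁻¹ * innerFun g Z B y) x :=
    ((mdifferentiableAt_innerFun g hZ hZ).inv (g.pos x (Z x) hZx).ne').mul
      (mdifferentiableAt_innerFun g hZ hB)
  have hprV : (fun y ↦ prV g Z y (B y)) =
      (fun y ↦ (innerFun g Z Z y)⁻¹ * innerFun g Z B y) • Z := by
    ext y
    simp [prV, innerFun]
  have hleibniz := (leviCivita g).isCovariantDerivativeOnUniv.leibniz hZ hb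
  simp only [secondFundamentalForm]
  rw [hprV]
  change prD g Z x ((leviCivita g).toFun _ x _) = _
  rw [hleibniz]
  simp only [_root_.add_apply, _root_.smul_apply, ContinuousLinearMap.smulRight_apply, map_add,
    map_smul, prD_self g hZx, smul_zero, add_zero, prV, innerFun, smul_eq_mul, smul_smul]

theorem inner_prD_leviCivita {u : M → ℝ} (hZ : IsSmoothField Z)
    (hunit : ∀ x, g₀.inner x (Z x) (Z x) = 1) (hu : u x ≠ 0)
    (hg : ∀ x v, g.inner x (Z x) v = u x * g₀.inner x (Z x) v) {X : VField E M}
    (hX : IsSmoothField X) :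
    g.inner x (prD g Z x (leviCivita g Z x (Z x))) (X x) =
      -(1 / 2) * mvfderiv 𝓘(ℝ, E) u x (prD g₀ Z x (X x))
        - u x * g₀.inner x (Z x) (mlieBracket 𝓘(ℝ, E) Z (fun y ↦ prD g₀ Z y (X y)) x) := by
  have hW := hZ.prD g₀ hunit hX
  have hZZ : innerFun g Z Z = u := by
    ext y
    simp [innerFun, hg, hunit]
  have hZW : innerFun g Z (fun y ↦ prD g₀ Z y (X y)) = fun _ ↦ 0 := by
    ext y
    simp [innerFun, hg, inner_prD_of_unit g₀ (hunit y)]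
  rw [inner_prD_left, prD_eq_of_inner_eq hu (hg x)]
  refine (inner_leviCivitaAt g (hZ.mdiffAt x) (hZ.mdiffAt x) (hW.mdiffAt x)).trans ?_
  simp only [koszul, derivAlong, hZZ, hZW, mvfderiv_const, mlieBracket_self, Pi.zero_apply,
    map_zero, _root_.zero_apply, g.symm x _ (Z x), hg]
  ring

theorem inner_meanCurvature (hZ : IsSmoothField Z) (hunit : ∀ x, g.inner x (Z x) (Z x) = 1)
    {X : VField E M} (hX : IsSmoothField X) :
    g.inner x (meanCurvature g Z x) (X x) =
      -g.inner x (Z x) (mlieBracket 𝓘(ℝ, E) Z (fun y ↦ prD g Z y (X y)) x) := by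
  rw [meanCurvature, secondFundamentalForm_eq_smul (hZ.mdiffAt x) (ne_zero_of_unit g (hunit x))
    (hZ.mdiffAt x), hunit, inv_one, one_mul, one_mul, one_smul,
    inner_prD_leviCivita (u := fun _ ↦ 1) hZ hunit one_ne_zero (by simp) hX]
  simp [mvfderiv_const]

theorem isTotallyGeodesic_iff_mvfderiv_prD [T2Space M] {u : M → ℝ}
    (hZ : IsSmoothField Z) (hunit : ∀ x, g₀.inner x (Z x) (Z x) = 1) (hu : ∀ x, u x ≠ 0)
    (hg : ∀ x v, g.inner x (Z x) v = u x * g₀.inner x (Z x) v) :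
    IsTotallyGeodesic g Z ↔ ∀ X : VField E M, IsSmoothField X → ∀ x,
      (1 / 2) * mvfderiv 𝓘(ℝ, E) u x (prD g₀ Z x (X x)) =
        u x * g₀.inner x (meanCurvature g₀ Z x) (X x) := by
  have hZ0 (x : M) := ne_zero_of_unit g₀ (hunit x)
  constructor
  · intro h X hX x
    have hII := h Z Z hZ hZ x
    rw [secondFundamentalForm_eq_smul (hZ.mdiffAt x) (hZ0 x) (hZ.mdiffAt x),
      inv_mul_cancel₀ (g.pos x (Z x) (hZ0 x)).ne', mul_one, one_smul] at hII
    have hinner := inner_prD_leviCivita hZ hunit (hu x) hg hX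
    simp only [hII, map_zero, _root_.zero_apply] at hinner
    rw [inner_meanCurvature hZ hunit hX]
    linarith
  · intro h A B _ hB x
    rw [secondFundamentalForm_eq_smul (hZ.mdiffAt x) (hZ0 x) (hB.mdiffAt x)]
    refine smul_eq_zero_of_right _ (ext_inner g x fun w ↦ ?_)
    obtain ⟨X, hX, rfl⟩ := exists_isSmoothField_apply_eq w
    have hcrit := h X hX x
    rw [inner_meanCurvature hZ hunit hX] at hcrit
    rw [inner_prD_leviCivita hZ hunit (hu x) hg hX, map_zero, _root_.zero_apply]
    linarith

theorem isTotallyGeodesic_iff_meanCurvature_eq [T2Space M] {h : M → ℝ} (hZ : IsSmoothField Z)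
    (hunit : ∀ x, g₀.inner x (Z x) (Z x) = 1) (hh : ContMDiff 𝓘(ℝ, E) 𝓘(ℝ) ∞ h)
    (hg : ∀ x v, g.inner x (Z x) v = Real.exp (2 * h x) * g₀.inner x (Z x) v) :
    IsTotallyGeodesic g Z ↔ ∀ x, meanCurvature g₀ Z x = horizontalGradient g₀ Z h x := by
  have hd (x : M) (v : TangentSpace 𝓘(ℝ, E) x) :
      mvfderiv 𝓘(ℝ, E) (fun y ↦ Real.exp (2 * h y)) x v =
        2 * Real.exp (2 * h x) * mvfderiv 𝓘(ℝ, E) h x v := by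
    refine mvfderiv_comp_real (φ := fun t ↦ Real.exp (2 * t)) ?_
      ((hh x).mdifferentiableAt (by simp)) v
    simpa [mul_comm] using ((hasDerivAt_id (h x)).const_mul 2).exp
  have hcrit (x : M) (v : TangentSpace 𝓘(ℝ, E) x) :
      (1 / 2) * mvfderiv 𝓘(ℝ, E) (fun y ↦ Real.exp (2 * h y)) x (prD g₀ Z x v) =
          Real.exp (2 * h x) * g₀.inner x (meanCurvature g₀ Z x) v ↔
        g₀.inner x (meanCurvature g₀ Z x) v = g₀.inner x (horizontalGradient g₀ Z h x) v := by
    rw [horizontalGradient, inner_sharp, hd, ContinuousLinearMap.comp_apply, mul_assoc,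
      ← mul_assoc, one_div_mul_cancel two_ne_zero, one_mul, mul_right_inj' (Real.exp_pos _).ne',
      eq_comm]
  rw [isTotallyGeodesic_iff_mvfderiv_prD hZ hunit (fun x ↦ (Real.exp_pos (2 * h x)).ne') hg]
  simp only [hcrit]
  refine ⟨fun H x ↦ ext_inner g₀ x fun w ↦ ?_, fun H X _ x ↦ by rw [H x]⟩
  obtain ⟨X, hX, rfl⟩ := exists_isSmoothField_apply_eq w
  exact H X hX x

end TotallyGeodesic

section Invariance

variable {E : Type*} [NormedAddCommGroup E] [NormedSpace ℝ E]
  {M : Type*} [TopologicalSpace M] [ChartedSpace E M] [IsManifold 𝓘(ℝ, E) ∞ M]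
  {g : Metric E M} {Z : VField E M} {h : M → ℝ} {x : M}

/-- The vector field `e^{-h} Z`. When the mean curvature of the leaves is `∇^D h`, its flow
preserves `D`, rescales `g(Z, ·)`, and does not change the transverse metric of a Riemannian
foliation. -/
def scaledField (Z : VField E M) (h : M → ℝ) : VField E M := (fun x ↦ Real.exp (-h x)) • Z

theorem IsSmoothField.scaledField (hZ : IsSmoothField Z) (hh : ContMDiff 𝓘(ℝ, E) 𝓘(ℝ) ∞ h) :
    IsSmoothField (scaledField Z h) :=
  .smul ((Real.contDiff_exp.comp contDiff_neg).contMDiff.comp hh) hZ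

variable [FiniteDimensional ℝ E]

theorem mlieBracket_scaledField_left (hZ : MDiffAt (T% Z) x) (hh : MDiffAt h x) (X : VField E M) :
    mlieBracket 𝓘(ℝ, E) (scaledField Z h) X x =
      Real.exp (-h x) • (mvfderiv 𝓘(ℝ, E) h x (X x) • Z x + mlieBracket 𝓘(ℝ, E) Z X x) := by
  have hexp : MDiffAt (fun y ↦ Real.exp (-h y)) x :=
    (Real.differentiable_exp.comp differentiable_neg _).mdifferentiableAt.comp x hh
  rw [scaledField, mlieBracket_smul_left hexp hZ, mvfderiv_exp_neg hh, smul_add, smul_smul,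
    neg_mul, neg_neg]

theorem inner_mlieBracket_scaledField_prD (hZ : IsSmoothField Z)
    (hunit : ∀ x, g.inner x (Z x) (Z x) = 1) (hh : MDiffAt h x)
    (hN : meanCurvature g Z x = horizontalGradient g Z h x) {X : VField E M}
    (hX : IsSmoothField X) :
    g.inner x (Z x) (mlieBracket 𝓘(ℝ, E) (scaledField Z h) (fun y ↦ prD g Z y (X y)) x) = 0 := by
  have hmean := inner_meanCurvature hZ hunit hX (x := x)
  rw [hN, horizontalGradient, inner_sharp, ContinuousLinearMap.comp_apply] at hmean
  rw [mlieBracket_scaledField_left (hZ.mdiffAt x) hh, map_smul, map_add, map_smul, hunit, hmean]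
  simp

theorem mlieBracket_scaledField (hZ : IsSmoothField Z) (hunit : ∀ x, g.inner x (Z x) (Z x) = 1)
    (hh : MDiffAt h x) {X : VField E M} (hX : IsSmoothField X) :
    mlieBracket 𝓘(ℝ, E) (scaledField Z h) X x =
      mlieBracket 𝓘(ℝ, E) (scaledField Z h) (fun y ↦ prD g Z y (X y)) x +
        (mvfderiv 𝓘(ℝ, E) (innerFun g Z X) x (scaledField Z h x) +
          mvfderiv 𝓘(ℝ, E) h x (scaledField Z h x) * g.inner x (Z x) (X x)) • Z x := by
  have hη : MDiffAt (innerFun g Z X) x := mdifferentiableAt_innerFun g (hZ.mdiffAt x) (hX.mdiffAt x)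
  have hsplit : X = (fun y ↦ prD g Z y (X y)) + innerFun g Z X • Z := by
    ext y
    simp [prD_apply_of_unit g (hunit y), innerFun]
  have hZZ : mlieBracket 𝓘(ℝ, E) (scaledField Z h) Z x =
      mvfderiv 𝓘(ℝ, E) h x (scaledField Z h x) • Z x := by
    rw [mlieBracket_scaledField_left (hZ.mdiffAt x) hh]
    simp [scaledField, smul_smul]
  conv_lhs => rw [hsplit, mlieBracket_add_right ((hZ.prD g hunit hX).mdiffAt x)
    (hη.smul_section (hZ.mdiffAt x)), mlieBracket_smul_right hη (hZ.mdiffAt x), hZZ, smul_smul,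
    ← add_smul]
  rw [innerFun, mul_comm (g.inner x (Z x) (X x))]

theorem prD_mlieBracket_scaledField (hZ : IsSmoothField Z)
    (hunit : ∀ x, g.inner x (Z x) (Z x) = 1) (hh : MDiffAt h x)
    (hN : meanCurvature g Z x = horizontalGradient g Z h x) {X : VField E M}
    (hX : IsSmoothField X) :
    prD g Z x (mlieBracket 𝓘(ℝ, E) (scaledField Z h) X x) =
      mlieBracket 𝓘(ℝ, E) (scaledField Z h) (fun y ↦ prD g Z y (X y)) x := by
  rw [mlieBracket_scaledField hZ hunit hh hX, map_add, map_smul,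
    prD_self g (ne_zero_of_unit g (hunit x)), prD_apply_of_unit g (hunit x),
    inner_mlieBracket_scaledField_prD hZ hunit hh hN hX]
  simp

theorem mvfderiv_innerFun_scaledField (hZ : IsSmoothField Z)
    (hunit : ∀ x, g.inner x (Z x) (Z x) = 1) (hh : MDiffAt h x)
    (hN : meanCurvature g Z x = horizontalGradient g Z h x) {X : VField E M}
    (hX : IsSmoothField X) :
    mvfderiv 𝓘(ℝ, E) (innerFun g Z X) x (scaledField Z h x) =
      g.inner x (Z x) (mlieBracket 𝓘(ℝ, E) (scaledField Z h) X x) -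
        mvfderiv 𝓘(ℝ, E) h x (scaledField Z h x) * g.inner x (Z x) (X x) := by
  rw [mlieBracket_scaledField hZ hunit hh hX, map_add,
    inner_mlieBracket_scaledField_prD hZ hunit hh hN hX, map_smul, hunit]
  simp

theorem mvfderiv_curvatureFun_scaledField (hZ : IsSmoothField Z)
    (hunit : ∀ x, g.inner x (Z x) (Z x) = 1) (hh : ContMDiff 𝓘(ℝ, E) 𝓘(ℝ) ∞ h)
    (hN : ∀ x, meanCurvature g Z x = horizontalGradient g Z h x) {X X' : VField E M}
    (hX : IsSmoothField X) (hX' : IsSmoothField X') :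
    mvfderiv 𝓘(ℝ, E) (curvatureFun g Z X X') x (scaledField Z h x) =
      curvatureFun g Z (mlieBracket 𝓘(ℝ, E) (scaledField Z h) X) X' x +
        curvatureFun g Z X (mlieBracket 𝓘(ℝ, E) (scaledField Z h) X') x -
        mvfderiv 𝓘(ℝ, E) h x (scaledField Z h x) * curvatureFun g Z X X' x := by
  have hhd (y : M) : MDiffAt h y := (hh y).mdifferentiableAt (by simp)
  have hprD {W : VField E M} (hW : IsSmoothField W) :
      (fun y ↦ prD g Z y (mlieBracket 𝓘(ℝ, E) (scaledField Z h) W y)) =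
        mlieBracket 𝓘(ℝ, E) (scaledField Z h) (fun y ↦ prD g Z y (W y)) :=
    funext fun y ↦ prD_mlieBracket_scaledField hZ hunit (hhd y) (hN y) hW
  have hDX := hZ.prD g hunit hX
  have hDX' := hZ.prD g hunit hX'
  simp only [curvatureFun, hprD hX, hprD hX']
  rw [mvfderiv_innerFun_scaledField hZ hunit (hhd x) (hN x) (hDX.mlieBracket hDX'),
    mlieBracket_leibniz (hZ.scaledField hh) hDX hDX', map_add]
  rfl

theorem mvfderiv_innerFun_scaledField_of_isRiemannianFoliation (hZ : IsSmoothField Z)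
    (hunit : ∀ x, g.inner x (Z x) (Z x) = 1) (hRiem : IsRiemannianFoliation g Z)
    (hh : ContMDiff 𝓘(ℝ, E) 𝓘(ℝ) ∞ h)
    (hN : meanCurvature g Z x = horizontalGradient g Z h x) {X X' : VField E M}
    (hX : IsSmoothField X) (hX' : IsSmoothField X') :
    mvfderiv 𝓘(ℝ, E) (innerFun g X X') x (scaledField Z h x) =
      g.inner x (mlieBracket 𝓘(ℝ, E) (scaledField Z h) X x) (X' x) +
        g.inner x (X x) (mlieBracket 𝓘(ℝ, E) (scaledField Z h) X' x) -
        2 * mvfderiv 𝓘(ℝ, E) h x (scaledField Z h x) *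
          (g.inner x (Z x) (X x) * g.inner x (Z x) (X' x)) := by
  have hhx : MDiffAt h x := (hh x).mdifferentiableAt (by simp)
  have hT : MDiffAt (fun y ↦ transverseMetric g Z y (X y) (X' y)) x :=
    mdifferentiableAt_innerFun g ((hZ.prD g hunit hX).mdiffAt x) ((hZ.prD g hunit hX').mdiffAt x)
  have hη {W : VField E M} (hW : IsSmoothField W) : MDiffAt (innerFun g Z W) x :=
    mdifferentiableAt_innerFun g (hZ.mdiffAt x) (hW.mdiffAt x)
  have hsplit : innerFun g X X' = (fun y ↦ transverseMetric g Z y (X y) (X' y)) +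
      innerFun g Z X * innerFun g Z X' :=
    funext fun y ↦ inner_eq_transverseMetric_add g (hunit y) _ _
  have hlie := hRiem (scaledField Z h) (hZ.scaledField hh)
    (fun y ↦ Submodule.smul_mem _ _ (Submodule.mem_span_singleton_self _)) X X' hX hX' x
  rw [lieDerivative, derivAlong] at hlie
  rw [hsplit, mvfderiv_add hT ((hη hX).mul (hη hX')), mvfderiv_mul (hη hX) (hη hX'),
    inner_eq_transverseMetric_add g (hunit x) (mlieBracket _ _ X x),
    inner_eq_transverseMetric_add g (hunit x) (X x)]
  simp only [_root_.add_apply, _root_.smul_apply, smul_eq_mul, innerFun,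
    mvfderiv_innerFun_scaledField hZ hunit hhx hN hX,
    mvfderiv_innerFun_scaledField hZ hunit hhx hN hX']
  linarith

theorem inner_mlieBracket_scaledField_add (hZ : IsSmoothField Z)
    (hunit : ∀ x, g.inner x (Z x) (Z x) = 1) (hRiem : IsRiemannianFoliation g Z)
    (hh : ContMDiff 𝓘(ℝ, E) 𝓘(ℝ) ∞ h)
    (hN : meanCurvature g Z x = horizontalGradient g Z h x) {ι : Type*} [DecidableEq ι]
    {e : ι → VField E M} (he : ∀ i, IsSmoothField (e i))
    (hon : ∀ᶠ y in nhds x, IsOrthonormal g (e · y)) (i k : ι) :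
    g.inner x (e k x) (mlieBracket 𝓘(ℝ, E) (scaledField Z h) (e i) x) +
        g.inner x (e i x) (mlieBracket 𝓘(ℝ, E) (scaledField Z h) (e k) x) =
      2 * mvfderiv 𝓘(ℝ, E) h x (scaledField Z h x) *
        (g.inner x (e i x) (Z x) * g.inner x (e k x) (Z x)) := by
  have hconst : innerFun g (e i) (e k) =ᶠ[nhds x] fun _ ↦ if i = k then 1 else 0 :=
    hon.mono fun y hy ↦ hy i k
  have hderiv := mvfderiv_innerFun_scaledField_of_isRiemannianFoliation hZ hunit hRiem hh hN
    (he i) (he k)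
  rw [mvfderiv_congr hconst, mvfderiv_const, _root_.zero_apply, g.symm x _ (e k x),
    g.symm x (Z x), g.symm x (Z x)] at hderiv
  linarith

theorem mvfderiv_sum_sq_curvatureFun_scaledField (hZ : IsSmoothField Z)
    (hunit : ∀ x, g.inner x (Z x) (Z x) = 1) (hRiem : IsRiemannianFoliation g Z)
    (hh : ContMDiff 𝓘(ℝ, E) 𝓘(ℝ) ∞ h)
    (hN : ∀ x, meanCurvature g Z x = horizontalGradient g Z h x)
    {e : Fin (Module.finrank ℝ E) → VField E M} (he : ∀ i, IsSmoothField (e i))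
    (hon : ∀ᶠ y in nhds x, IsOrthonormal g (e · y)) :
    mvfderiv 𝓘(ℝ, E) (fun y ↦ ∑ p : _ × _, curvatureFun g Z (e p.1) (e p.2) y ^ 2) x
        (scaledField Z h x) =
      -2 * mvfderiv 𝓘(ℝ, E) h x (scaledField Z h x) *
        ∑ p : _ × _, curvatureFun g Z (e p.1) (e p.2) x ^ 2 := by
  let Ω i j := curvatureFun g Z (e i) (e j) x
  let A i k := g.inner x (e k x) (mlieBracket 𝓘(ℝ, E) (scaledField Z h) (e i) x)
  let c := mvfderiv 𝓘(ℝ, E) h x (scaledField Z h x)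
  have hbracket i := ((hZ.scaledField hh).mlieBracket (he i)).mdiffAt x
  have hexpand {X : VField E M} (hX : MDiffAt (T% X) x) (j) :
      curvatureFun g Z X (e j) x = ∑ k, g.inner x (e k x) (X x) * Ω k j :=
    curvatureFun_eq_sum g (hZ.mdiffAt x) (hunit x) (fun i ↦ (he i).mdiffAt x) hon.self_of_nhds hX
      ((he j).mdiffAt x)
  have hderiv i j : mvfderiv 𝓘(ℝ, E) (curvatureFun g Z (e i) (e j)) x (scaledField Z h x) =
      ∑ k, A i k * Ω k j - ∑ k, A j k * Ω k i - c * Ω i j := by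
    rw [mvfderiv_curvatureFun_scaledField hZ hunit hh hN (he i) (he j),
      curvatureFun_swap g (e i) (mlieBracket _ _ _), hexpand (hbracket i), hexpand (hbracket j),
      ← sub_eq_add_neg]
  have hker j : ∑ i, g.inner x (e i x) (Z x) * Ω i j = 0 := by
    rw [← hexpand (hZ.mdiffAt x), curvatureFun_self_left g fun y ↦ ne_zero_of_unit g (hunit y)]
    rfl
  have hA := sum_mul_sum_mul_eq_zero
    (inner_mlieBracket_scaledField_add hZ hunit hRiem hh (hN x) he hon) hker
  have hA' : ∑ i, ∑ j, Ω i j * ∑ k, A j k * Ω k i = 0 := by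
    rw [Finset.sum_comm, ← neg_eq_zero, ← hA]
    simp only [← Finset.sum_neg_distrib, ← neg_mul, Ω, ← curvatureFun_swap]
    rfl
  rw [mvfderiv_sum_sq fun p _ ↦
    (contMDiff_curvatureFun g hZ hunit (he p.1) (he p.2) x).mdifferentiableAt (by simp)]
  simp only [hderiv, Fintype.sum_prod_type]
  calc 2 * ∑ i, ∑ j, Ω i j * (∑ k, A i k * Ω k j - ∑ k, A j k * Ω k i - c * Ω i j)
      = 2 * (∑ i, ∑ j, Ω i j * ∑ k, A i k * Ω k j - ∑ i, ∑ j, Ω i j * ∑ k, A j k * Ω k i -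
          c * ∑ i, ∑ j, Ω i j ^ 2) := by
        simp only [mul_sub, Finset.sum_sub_distrib, sq, Finset.mul_sum, mul_left_comm c]
    _ = -2 * c * ∑ i, ∑ j, Ω i j ^ 2 := by
        rw [hA', show ∑ i, ∑ j, Ω i j * ∑ k, A i k * Ω k j = 0 from hA]
        ring

theorem mvfderiv_log_curvatureNorm [T2Space M] (hZ : IsSmoothField Z)
    (hunit : ∀ x, g.inner x (Z x) (Z x) = 1) (hRiem : IsRiemannianFoliation g Z)
    (hcurv : ∃ v w, curvatureAt g Z x v w ≠ 0) (hh : ContMDiff 𝓘(ℝ, E) 𝓘(ℝ) ∞ h)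
    (hN : ∀ x, meanCurvature g Z x = horizontalGradient g Z h x) :
    mvfderiv 𝓘(ℝ, E) (fun y ↦ Real.log (curvatureNorm g Z y)) x (Z x) =
      -mvfderiv 𝓘(ℝ, E) h x (Z x) := by
  obtain ⟨e, he, hon⟩ := exists_orthonormal_fields g x _ le_rfl
  let S : M → ℝ := fun y ↦ ∑ p : _ × _, curvatureFun g Z (e p.1) (e p.2) y ^ 2
  have hpos : 0 < S x := sum_sq_curvatureFun_pos g hZ (hunit x) hcurv he hon.self_of_nhds
  have hS : MDiffAt S x := (contMDiffAt_finsetSum fun p _ ↦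
    (contMDiff_curvatureFun g hZ hunit (he p.1) (he p.2) x).pow 2).mdifferentiableAt (by simp)
  have hlog : HasDerivAt (fun t ↦ (1 / 2) * Real.log ((1 / 2) * t)) (1 / (2 * S x)) (S x) := by
    convert! (((hasDerivAt_id (S x)).const_mul (1 / 2)).log (by positivity)).const_mul (1 / 2)
      using 1
    simp only [id_eq, mul_one]
    field_simp
  have hS' : mvfderiv 𝓘(ℝ, E) S x (scaledField Z h x) =
      -2 * mvfderiv 𝓘(ℝ, E) h x (scaledField Z h x) * S x :=
    mvfderiv_sum_sq_curvatureFun_scaledField hZ hunit hRiem hh hN he hon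
  have hscaled : mvfderiv 𝓘(ℝ, E) (fun y ↦ Real.log (curvatureNorm g Z y)) x (scaledField Z h x) =
      -mvfderiv 𝓘(ℝ, E) h x (scaledField Z h x) := by
    rw [mvfderiv_congr (log_curvatureNorm_eventuallyEq g hZ hunit he hon),
      mvfderiv_comp_real hlog hS, hS']
    field_simp
  simpa [scaledField, ← mul_neg, (Real.exp_pos _).ne'] using hscaled

end Invariance

section HorizontalGradient

variable {E : Type*} [NormedAddCommGroup E] [NormedSpace ℝ E] [FiniteDimensional ℝ E]
  {M : Type*} [TopologicalSpace M] [ChartedSpace E M] [IsManifold 𝓘(ℝ, E) ∞ M]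
  (g : Metric E M) {Z : VField E M} {x : M}

theorem horizontalGradient_eq_gradient (hunit : g.inner x (Z x) (Z x) = 1) {f : M → ℝ}
    (hf : mvfderiv 𝓘(ℝ, E) f x (Z x) = 0) : horizontalGradient g Z f x = gradient g f x := by
  refine congrArg (sharp g x) (ContinuousLinearMap.ext fun v ↦ ?_)
  simp [prD_apply_of_unit g hunit, hf]

theorem horizontalGradient_sub {f r : M → ℝ} (hf : MDiffAt f x) (hr : MDiffAt r x) :
    horizontalGradient g Z (f - r) x =
      horizontalGradient g Z f x - horizontalGradient g Z r x := by
  rw [horizontalGradient, mvfderiv_sub hf hr, ContinuousLinearMap.sub_comp, map_sub]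
  rfl

theorem mvfderiv_eq_zero_of_meanCurvature_eq (hunit : g.inner x (Z x) (Z x) = 1) {f r : M → ℝ}
    (hN : meanCurvature g Z x = -horizontalGradient g Z r x + gradient g f x) :
    mvfderiv 𝓘(ℝ, E) f x (Z x) = 0 := by
  have hinner := congr(g.inner x $hN (Z x))
  simpa [meanCurvature, secondFundamentalForm, inner_prD_left, horizontalGradient, gradient,
    inner_sharp, prD_self g (ne_zero_of_unit g hunit)] using hinner.symm

end HorizontalGradient

end LineFoliation

end

theorem mainTheorem9_general
    {E : Type*} [NormedAddCommGroup E] [NormedSpace ℝ E] [FiniteDimensional ℝ E]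
    {M : Type*} [TopologicalSpace M] [ChartedSpace E M] [IsManifold 𝓘(ℝ, E) ∞ M] [T2Space M]
    (g₀ : LineFoliation.Metric E M)
    (Z : LineFoliation.VField E M) (hZ : LineFoliation.IsSmoothField Z)
    (hunit : ∀ x, g₀.inner x (Z x) (Z x) = 1)
    (hRiem : LineFoliation.IsRiemannianFoliation g₀ Z)
    (hcurv : ∀ x, ∃ v w, LineFoliation.curvatureAt g₀ Z x v w ≠ 0) :
    (∃ g : LineFoliation.Metric E M,
      (∀ x, ∀ v ∈ LineFoliation.horizontal g₀ Z x, ∀ w ∈ LineFoliation.vertical Z x,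
        g.inner x v w = 0) ∧
      LineFoliation.IsTotallyGeodesic g Z) ↔
    ∃ f : M → ℝ, ContMDiff 𝓘(ℝ, E) 𝓘(ℝ) ∞ f ∧
      ∀ x, LineFoliation.meanCurvature g₀ Z x =
        - LineFoliation.horizontalGradient g₀ Z
            (fun y ↦ Real.log (LineFoliation.curvatureNorm g₀ Z y)) x
          + LineFoliation.gradient g₀ f x := by
  open LineFoliation in
  let r : M → ℝ := fun x ↦ Real.log (curvatureNorm g₀ Z x)
  have hr : ContMDiff 𝓘(ℝ, E) 𝓘(ℝ) ∞ r := contMDiff_log_curvatureNorm g₀ hZ hunit hcurv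
  have hmdiff {f : M → ℝ} (hf : ContMDiff 𝓘(ℝ, E) 𝓘(ℝ) ∞ f) (x : M) : MDiffAt f x :=
    (hf x).mdifferentiableAt (by simp)
  constructor
  · rintro ⟨g, horth, hgeod⟩
    obtain ⟨h, hh, hg⟩ := exists_inner_eq_exp_mul hZ hunit horth
    have hN := (isTotallyGeodesic_iff_meanCurvature_eq hZ hunit hh hg).1 hgeod
    have hfZ (x : M) : mvfderiv 𝓘(ℝ, E) (h + r) x (Z x) = 0 := by
      rw [mvfderiv_add (hmdiff hh x) (hmdiff hr x), _root_.add_apply,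
        mvfderiv_log_curvatureNorm hZ hunit hRiem (hcurv x) hh hN, add_neg_cancel]
    refine ⟨h + r, hh.add hr, fun x ↦ ?_⟩
    rw [← horizontalGradient_eq_gradient g₀ (hunit x) (hfZ x), neg_add_eq_sub,
      ← horizontalGradient_sub g₀ (hmdiff (hh.add hr) x) (hmdiff hr x), add_sub_cancel_right, hN x]
  · rintro ⟨f, hf, hN⟩
    refine ⟨conformal g₀ (f - r) (hf.sub hr), fun x v hv w hw ↦ ?_, ?_⟩
    · exact inner_conformal_eq_zero hv hw
    · refine (isTotallyGeodesic_iff_meanCurvature_eq (h := f - r) hZ hunit (hf.sub hr)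
        fun _ _ ↦ rfl).2 fun x ↦ ?_
      have hfZ := mvfderiv_eq_zero_of_meanCurvature_eq g₀ (hunit x) (hN x)
      rw [hN x, horizontalGradient_sub g₀ (hmdiff hf x) (hmdiff hr x),
        horizontalGradient_eq_gradient g₀ (hunit x) hfZ, neg_add_eq_sub]

theorem mainTheorem9
    {E : Type*} [NormedAddCommGroup E] [NormedSpace ℝ E] [FiniteDimensional ℝ E]
    {M : Type*} [TopologicalSpace M] [ChartedSpace E M] [IsManifold 𝓘(ℝ, E) ∞ M]
    [T2Space M] [SecondCountableTopology M] [SimplyConnectedSpace M]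
    (g₀ : LineFoliation.Metric E M)
    (Z : LineFoliation.VField E M) (hZ : LineFoliation.IsSmoothField Z)
    (hunit : ∀ x, g₀.inner x (Z x) (Z x) = 1)
    (hRiem : LineFoliation.IsRiemannianFoliation g₀ Z)
    (hcurv : ∀ x, ∃ v w, LineFoliation.curvatureAt g₀ Z x v w ≠ 0) :
    (∃ g : LineFoliation.Metric E M,
      (∀ x, ∀ v ∈ LineFoliation.horizontal g₀ Z x, ∀ w ∈ LineFoliation.vertical Z x,
        g.inner x v w = 0) ∧
      LineFoliation.IsTotallyGeodesic g Z) ↔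
    ∃ f : M → ℝ, ContMDiff 𝓘(ℝ, E) 𝓘(ℝ) ∞ f ∧
      ∀ x, LineFoliation.meanCurvature g₀ Z x =
        - LineFoliation.horizontalGradient g₀ Z
            (fun y ↦ Real.log (LineFoliation.curvatureNorm g₀ Z y)) x
          + LineFoliation.gradient g₀ f x :=
  mainTheorem9_general g₀ Z hZ hunit hRiem hcurv
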